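/- Let $\varepsilon>0$ and let $u=u(x,t)$, $x\in\mathbb R$, $t\ge 0$, be a continuous weak solution of the sine-Gordon equation $\varepsilon^2u_{tt}-\varepsilon^2u_{xx}+\sin u=0$, in the sense that Duhamel's formula $$u(x,t)=\tfrac12\big(u(x+t,0)+u(x-t,0)\big)+\tfrac12\int_{x-t}^{x+t}u_t(y,0)\,dy-\frac1{2\varepsilon^2}\int_0^t\int_{x-(t-s)}^{x+(t-s)}\sin u(y,s)\,dy\,ds$$ holds. Assume that $u$ has $L^1$-Sobolev regularity: $1-\cos u$, $\sin u$, $u_x$, $u_{xx}$, $u_t$, $u_{tx}$ exist in the sense of distributions and lie in $L^1(\mathbb R)$ as functions of $x$ for every $t\ge0$ (the $t$-derivative being that of the distribution-valued curve $t\mapsto u(\cdot,t)$, one-sided at $t=0$). For $z\in\mathbb C\setminus\{0\}$ put $D(z)=\frac14(z+z^{-1})$, $E(z)=\frac14(z-z^{-1})$, and at each time $t$ consider, with $f=u(\cdot,t)$ and $g=\varepsilon u_t(\cdot,t)$, the linear system $$4i\varepsilon\,\mathbf w_x=\begin{bmatrix}4E+z^{-1}(1-\cos f)&-z^{-1}\sin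 f-i(\varepsilon f'+g)\\-z^{-1}\sin f+i(\varepsilon f'+g)&-4E-z^{-1}(1-\cos f)\end{bmatrix}\mathbf w\qquad(*)$$ (solutions are locally absolutely continuous). The Jost solutions $\mathbf j_1^\pm(x;z,t)$, $\mathbf j_2^\pm(x;z,t)$ are the solutions of $(*)$ normalized by $\mathbf j_1^\pm e^{iEx/\varepsilon}\to[1,0]^{\mathsf T}$ and $\mathbf j_2^\pm e^{-iEx/\varepsilon}\to[0,1]^{\mathsf T}$ as $x\to\pm\infty$. For real $z\ne 0$ put $\mathbf J^\pm=[\mathbf j_1^\pm,\mathbf j_2^\pm]$; the scattering matrix $\mathbf S(z;t)$ is defined by $\mathbf J^+(x)=\mathbf J^-(x)\mathbf S(z;t)$ for all $x$. The diagonal entries are extended to $\Im z\le0$, respectively $\Im z\ge0$ ($z\neq 0$) by $S_{11}(z;t)=\det[\mathbf j_1^+,\mathbf j_2^-]$ and $S_{22}(z;t)=\det[\mathbf j_1^-,\mathbf j_2^+]$. An eigenvalue at time $t$ is a $z\in\mathbb C\setminus\{0\}$ for which $(*)$ has a nontrivial solution in $L^2(\mathbb R)$; at an eigenvalue $z_n$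 with $\Im z_n>0$ the proportionality constant $\eta_n(t)$ is defined by $\mathbf j_1^-(x;z_n,t)=\eta_n(t)\,\mathbf j_2^+(x;z_n,t)$ for all $x$. Then, for all $t\ge0$ and $z\neq0$, these data are well defined: $\mathbf j_1^+,\mathbf j_2^-$ exist and are unique if $\Im z\le0$; $\mathbf j_1^-,\mathbf j_2^+$ exist and are unique if $\Im z\ge0$; for real $z$ the matrix $\mathbf S(z;t)$ exists and is unique, and its diagonal entries are the determinants above, which do not depend on $x$. Moreover: 1. $S_{11}(z;t)$ (for $\Im z\le 0$) and $S_{22}(z;t)$ (for $\Im z\ge0$) are independent of $t$, and the set of eigenvalues is independent of $t$. 2. For real $z\ne0$, $S_{12}(z;t)=S_{12}(z;0)e^{-2iD(z)t/\varepsilon}$ and $S_{21}(z;t)=S_{21}(z;0)e^{2iD(z)t/\varepsilon}$. 3. For every eigenvalue $z_n$ with $\Im z_n>0$ the constant $\eta_n(t)$ exists, is unique and nonzero, and $\eta_n(t)=\eta_n(0)e^{2iD(z_n)t/\varepsilon}$. -/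

import Mathlib

open Filter Topology MeasureTheory
open scoped ContDiff

namespace SineGordon

noncomputable section

/-! ### Solutions of the sine-Gordon equation -/

/-- `g` is the derivative of `f` on the real line in the sense of distributions. -/
def HasWeakDeriv (f g : ℝ → ℝ) : Prop :=
  LocallyIntegrable f ∧ LocallyIntegrable g ∧
    ∀ φ : ℝ → ℝ, ContDiff ℝ ∞ φ → HasCompactSupport φ →
      ∫ x, f x * deriv φ x = -∫ x, g x * φ x

/-- `v` is the time derivative of `u` on `[0, ∞)` in the sense of distributions in `x`: for every
time `t ≥ 0` (one-sided at `t = 0`) the curve `s ↦ u(·, s)` of distributions has derivative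
`v(·, t)`. -/
def HasWeakTimeDeriv (u v : ℝ → ℝ → ℝ) : Prop :=
  ∀ φ : ℝ → ℝ, ContDiff ℝ ∞ φ → HasCompactSupport φ → ∀ t : ℝ, 0 ≤ t →
    HasDerivWithinAt (fun s : ℝ => ∫ x, u x s * φ x) (∫ x, v x t * φ x) (Set.Ici 0) t

/-- `u` is a weak solution, for `t ≥ 0`, of `ε² u_tt - ε² u_xx + sin u = 0` with initial
velocity `v₀ = u_t(·, 0)`: it is continuous and satisfies Duhamel's formula. -/
structure IsWeakSolution (ε : ℝ) (u : ℝ → ℝ → ℝ) (v₀ : ℝ → ℝ) : Prop where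
  continuousOn : ContinuousOn (fun q : ℝ × ℝ => u q.1 q.2) (Set.univ ×ˢ Set.Ici 0)
  duhamel : ∀ x t : ℝ, 0 ≤ t →
    u x t = (u (x + t) 0 + u (x - t) 0) / 2 + (∫ y in (x - t)..(x + t), v₀ y) / 2
      - 1 / (2 * ε ^ 2) *
        ∫ s in (0 : ℝ)..t, ∫ y in (x - (t - s))..(x + (t - s)), Real.sin (u y s)

/-- `L¹`-Sobolev regularity of `u`: the distributional derivatives `ux = u_x`, `uxx = u_xx`,
`ut = u_t`, `utx = u_tx` exist, and together with `1 - cos u` and `sin u` they are in `L¹(ℝ)` as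
functions of `x` for every `t ≥ 0`. -/
structure HasL1SobolevRegularity (u ux uxx ut utx : ℝ → ℝ → ℝ) : Prop where
  weakDeriv_x : ∀ t, 0 ≤ t → HasWeakDeriv (fun x => u x t) (fun x => ux x t)
  weakDeriv_xx : ∀ t, 0 ≤ t → HasWeakDeriv (fun x => ux x t) (fun x => uxx x t)
  weakDeriv_t : HasWeakTimeDeriv u ut
  weakDeriv_tx : ∀ t, 0 ≤ t → HasWeakDeriv (fun x => ut x t) (fun x => utx x t)
  integrable_cos : ∀ t, 0 ≤ t → Integrable fun x => 1 - Real.cos (u x t)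
  integrable_sin : ∀ t, 0 ≤ t → Integrable fun x => Real.sin (u x t)
  integrable_ux : ∀ t, 0 ≤ t → Integrable fun x => ux x t
  integrable_uxx : ∀ t, 0 ≤ t → Integrable fun x => uxx x t
  integrable_ut : ∀ t, 0 ≤ t → Integrable fun x => ut x t
  integrable_utx : ∀ t, 0 ≤ t → Integrable fun x => utx x t

/-! ### The scattering problem -/

/-- The potentials of the scattering problem: `f`, (a representative of) its derivative `f'`,
and `g`. -/
structure Potential where
  f : ℝ → ℝ
  f' : ℝ → ℝ
  g : ℝ → ℝ

/-- The potentials `f = u(·, t)` and `g = ε u_t(·, t)` at time `t`. -/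
def potentialAt (ε : ℝ) (u ux ut : ℝ → ℝ → ℝ) (t : ℝ) : Potential where
  f x := u x t
  f' x := ux x t
  g x := ε * ut x t

/-- `D(z) = (z + 1/z) / 4`. -/
def specD (z : ℂ) : ℂ := (z + z⁻¹) / 4

/-- `E(z) = (z - 1/z) / 4`. -/
def specE (z : ℂ) : ℂ := (z - z⁻¹) / 4

/-- The decaying part `Q` of the coefficient matrix. -/
def matQ (ε : ℝ) (P : Potential) (z : ℂ) (x : ℝ) : Matrix (Fin 2) (Fin 2) ℂ :=
  !![z⁻¹ * (1 - Real.cos (P.f x)),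
      -z⁻¹ * Real.sin (P.f x) - Complex.I * (ε * P.f' x + P.g x);
    -z⁻¹ * Real.sin (P.f x) + Complex.I * (ε * P.f' x + P.g x),
      -z⁻¹ * (1 - Real.cos (P.f x))]

/-- The coefficient matrix `4 E σ₃ + Q`. -/
def matL (ε : ℝ) (P : Potential) (z : ℂ) (x : ℝ) : Matrix (Fin 2) (Fin 2) ℂ :=
  !![4 * specE z, 0; 0, -(4 * specE z)] + matQ ε P z x

/-- `w` solves `4 i ε w_x = (4 E σ₃ + Q) w`, in integrated form (that is, `w` is locally absolutely
continuous and the equation holds almost everywhere). -/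
def IsEigenSolution (ε : ℝ) (P : Potential) (z : ℂ) (w : ℝ → Fin 2 → ℂ) : Prop :=
  Continuous w ∧ ∀ a b : ℝ, ∀ i : Fin 2,
    4 * Complex.I * ε * (w b i - w a i) = ∫ x in a..b, (matL ε P z x).mulVec (w x) i

/-- The diagonal entries `1, -1` of `σ₃`. -/
def sigma3 (k : Fin 2) : ℂ := if k = 0 then 1 else -1

/-- `j` is the `k`-th Jost solution (`k = 0, 1` for the first and second column) normalized at
`+∞` (`l = atTop`) or at `-∞` (`l = atBot`): a solution `j` such that
`j(x) exp(± i E x / ε)` tends to the `k`-th unit vector (`+` for the first column, `-` for the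
second). -/
def IsJost (ε : ℝ) (P : Potential) (z : ℂ) (k : Fin 2) (l : Filter ℝ)
    (j : ℝ → Fin 2 → ℂ) : Prop :=
  IsEigenSolution ε P z j ∧
    Tendsto (fun x : ℝ => Complex.exp (sigma3 k * Complex.I * specE z * x / ε) • j x) l
      (𝓝 (Pi.single k 1))

/-- The Jost solution. -/
def jost (ε : ℝ) (P : Potential) (z : ℂ) (k : Fin 2) (l : Filter ℝ) : ℝ → Fin 2 → ℂ :=
  Classical.epsilon (IsJost ε P z k l)

/-- The matrix of Jost solutions: `J⁺` for `l = atTop`, `J⁻` for `l = atBot`. -/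
def jostMatrix (ε : ℝ) (P : Potential) (z : ℂ) (l : Filter ℝ) (x : ℝ) :
    Matrix (Fin 2) (Fin 2) ℂ :=
  Matrix.of fun i k => jost ε P z k l x i

/-- `S` is a scattering matrix: `J⁺(x) = J⁻(x) S` for all `x`. -/
def IsScatteringMatrix (ε : ℝ) (P : Potential) (z : ℝ) (S : Matrix (Fin 2) (Fin 2) ℂ) : Prop :=
  ∀ x : ℝ, jostMatrix ε P z atTop x = jostMatrix ε P z atBot x * S

/-- The scattering matrix at real `z`. -/
def scatteringMatrix (ε : ℝ) (P : Potential) (z : ℝ) : Matrix (Fin 2) (Fin 2) ℂ :=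
  Classical.epsilon (IsScatteringMatrix ε P z)

/-- `det [v, w]`. -/
def wronskian (v w : Fin 2 → ℂ) : ℂ := v 0 * w 1 - v 1 * w 0

/-- The extension of `S₁₁` to the closed lower half-plane, `det [j₁⁺(x), j₂⁻(x)]`
(independent of `x`). -/
def extS11 (ε : ℝ) (P : Potential) (z : ℂ) (x : ℝ) : ℂ :=
  wronskian (jost ε P z 0 atTop x) (jost ε P z 1 atBot x)

/-- The extension of `S₂₂` to the closed upper half-plane, `det [j₁⁻(x), j₂⁺(x)]`
(independent of `x`). -/
def extS22 (ε : ℝ) (P : Potential) (z : ℂ) (x : ℝ) : ℂ :=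
  wronskian (jost ε P z 0 atBot x) (jost ε P z 1 atTop x)

/-- `z` is an eigenvalue of the scattering problem: there is a nontrivial square-integrable
solution. -/
def IsEigenvalue (ε : ℝ) (P : Potential) (z : ℂ) : Prop :=
  z ≠ 0 ∧ ∃ w : ℝ → Fin 2 → ℂ, IsEigenSolution ε P z w ∧ w ≠ 0 ∧ MemLp w 2

/-- `η` is a proportionality constant at `z`: `j₁⁻(x) = η j₂⁺(x)` for all `x`. -/
def IsPropConst (ε : ℝ) (P : Potential) (z : ℂ) (η : ℂ) : Prop :=
  ∀ x : ℝ, jost ε P z 0 atBot x = η • jost ε P z 1 atTop x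

/-- The proportionality constant at an eigenvalue `z` in the open upper half-plane. -/
def propConst (ε : ℝ) (P : Potential) (z : ℂ) : ℂ :=
  Classical.epsilon (IsPropConst ε P z)

end

end SineGordon

open SineGordon

/-! The proof uses the Lax pair in characteristic form. Besides the scattering problem, solutions
carried along in time obey (∂ₜ - ∂ₓ) w = `charMatrix` (u) w, whose coefficients contain u but none
of its derivatives. On each line x + t = c this is a linear ODE with bounded continuous coefficients
that are C¹ in c, so it makes sense for a solution u that is merely C¹.

Compatibility of the two systems needs only the first order identity (∂ₜ - ∂ₓ)(u_x + u_t) = -ε⁻² sin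
u along these lines, and Duhamel's formula yields it in the classical sense
(`exists_isCharacteristicSol`). Write L for the coefficient matrix of the scattering problem in the
form w' = L w. If a(c, s) solves the characteristic ODE, then L a solves that ODE differentiated in
c (`IsCharacteristicSol.hasDerivAt_linCoeff_mulVec`). Hence ∂_c a = L a holds at one end of the time
interval exactly when it holds at the other (`IsCharacteristicSol.isLinSol_iff`).

The propagator T(c) along the line x + t = c therefore carries solutions of the scattering problem
at time 0 to solutions at time t. It has determinant 1, so it preserves Wronskians, and it is
bounded uniformly in c together with its inverse, so it preserves square integrability and
eigenvalues. At both ends cos u → 1 and sin u → 0, so `charMatrix` tends to a diagonal matrix and T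
takes the k-th Jost solution to an explicit multiple of the k-th Jost solution; the correcting
factor is exp(± i D t / ε) (`IsCharacteristicSol.exists_isTransport`). The scattering coefficients
are Wronskians of Jost solutions, so the exponents add: they cancel on the diagonal and double off
it. The constant η picks up the ratio of the two factors.

At a fixed time, Jost solutions exist by a Volterra equation solved as a contraction in a weighted
norm (`exists_volterra`). Uniqueness and the treatment of eigenvalues rest on constancy of the
Wronskian. -/

namespace SineGordon

open scoped Matrix.Norms.Operator

/-! ### Linear systems of two first order equations -/

/-- `w` is a (classical) solution of `w' = B w`. -/
def IsLinSol (B : ℝ → Matrix (Fin 2) (Fin 2) ℂ) (w : ℝ → Fin 2 → ℂ) : Prop :=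
  ∀ x, HasDerivAt w ((B x).mulVec (w x)) x

lemma IsLinSol.continuous {B : ℝ → Matrix (Fin 2) (Fin 2) ℂ} {w : ℝ → Fin 2 → ℂ}
    (h : IsLinSol B w) : Continuous w :=
  continuous_iff_continuousAt.2 fun x => (h x).continuousAt

lemma IsLinSol.smul {B : ℝ → Matrix (Fin 2) (Fin 2) ℂ} {w : ℝ → Fin 2 → ℂ}
    (h : IsLinSol B w) (c : ℂ) : IsLinSol B (fun x => c • w x) := fun x => by
  rw [Matrix.mulVec_smul]; exact (h x).const_smul c

lemma IsLinSol.add {B : ℝ → Matrix (Fin 2) (Fin 2) ℂ} {v w : ℝ → Fin 2 → ℂ}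
    (hv : IsLinSol B v) (hw : IsLinSol B w) : IsLinSol B (fun x => v x + w x) := fun x => by
  rw [Matrix.mulVec_add]; exact (hv x).add (hw x)

lemma IsLinSol.sub {B : ℝ → Matrix (Fin 2) (Fin 2) ℂ} {v w : ℝ → Fin 2 → ℂ}
    (hv : IsLinSol B v) (hw : IsLinSol B w) : IsLinSol B (fun x => v x - w x) := fun x => by
  rw [Matrix.mulVec_sub]; exact (hv x).sub (hw x)

/-- Liouville's formula: the derivative of the Wronskian is the trace of the coefficient matrix
times the Wronskian. Constancy of Wronskians, used throughout, comes from here. -/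
lemma hasDerivAt_wronskian {B : Matrix (Fin 2) (Fin 2) ℂ} (hB : B 0 0 + B 1 1 = 0)
    {v w : ℝ → Fin 2 → ℂ} {x : ℝ} (hv : HasDerivAt v (B.mulVec (v x)) x)
    (hw : HasDerivAt w (B.mulVec (w x)) x) :
    HasDerivAt (fun y => wronskian (v y) (w y)) 0 x := by
  rw [hasDerivAt_pi] at hv hw
  have h := ((hv 0).fun_mul (hw 1)).fun_sub ((hv 1).fun_mul (hw 0))
  refine h.congr_deriv ?_
  simp only [Matrix.mulVec, dotProduct, Fin.sum_univ_two]
  linear_combination (v x 0 * w x 1 - v x 1 * w x 0) * hB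

lemma IsLinSol.wronskian_eq {B : ℝ → Matrix (Fin 2) (Fin 2) ℂ} {v w : ℝ → Fin 2 → ℂ}
    (hB : ∀ x, B x 0 0 + B x 1 1 = 0) (hv : IsLinSol B v) (hw : IsLinSol B w) (x y : ℝ) :
    wronskian (v x) (w x) = wronskian (v y) (w y) :=
  is_const_of_deriv_eq_zero
    (fun x => (hasDerivAt_wronskian (hB x) (hv x) (hw x)).differentiableAt)
    (fun x => (hasDerivAt_wronskian (hB x) (hv x) (hw x)).deriv) x y

lemma IsLinSol.eq_zero {B : ℝ → Matrix (Fin 2) (Fin 2) ℂ} (hB : Continuous B)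
    {w : ℝ → Fin 2 → ℂ} (hw : IsLinSol B w) {x₀ : ℝ} (h0 : w x₀ = 0) : w = 0 := by
  funext x
  -- The coefficients are bounded only on compact sets, so the uniqueness theorem is applied on an
  -- interval containing both points in its interior.
  obtain ⟨a, b, ha, hb, hxa, hxb⟩ : ∃ a b, a < x₀ ∧ x₀ < b ∧ a < x ∧ x < b :=
    ⟨min x₀ x - 1, max x₀ x + 1, by linarith [min_le_left x₀ x], by linarith [le_max_left x₀ x],
      by linarith [min_le_right x₀ x], by linarith [le_max_right x₀ x]⟩
  obtain ⟨K, hK⟩ := isCompact_Icc.exists_bound_of_continuousOn (hB.continuousOn (s := Set.Icc a b))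
  have hK0 : 0 ≤ K := (norm_nonneg _).trans (hK x₀ ⟨ha.le, hb.le⟩)
  have := ODE_solution_unique_of_mem_Icc (v := fun t w => (B t).mulVec w) (K := K.toNNReal)
    (s := fun _ => Set.univ) (f := w) (g := 0) (a := a) (b := b) (t₀ := x₀)
    (fun t ht => by
      refine LipschitzOnWith.of_dist_le_mul fun v _ v' _ => ?_
      rw [dist_eq_norm, dist_eq_norm, ← Matrix.mulVec_sub, Real.coe_toNNReal _ hK0]
      exact (Matrix.linfty_opNorm_mulVec _ _).trans
        (mul_le_mul_of_nonneg_right (hK t ⟨ht.1.le, ht.2.le⟩) (norm_nonneg _)))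
    ⟨ha, hb⟩ hw.continuous.continuousOn (fun t _ => hw t) (by simp)
    continuousOn_const (fun t _ => by simp [hasDerivAt_zero])
    (by simp) h0
  exact this ⟨hxa.le, hxb.le⟩

lemma IsLinSol.eq_of_eq {B : ℝ → Matrix (Fin 2) (Fin 2) ℂ} (hB : Continuous B)
    {v w : ℝ → Fin 2 → ℂ} (hv : IsLinSol B v) (hw : IsLinSol B w) {x₀ : ℝ} (h0 : v x₀ = w x₀) :
    v = w := by
  have := (hv.sub hw).eq_zero hB (x₀ := x₀) (by simp [h0])
  funext x
  exact sub_eq_zero.1 (congrFun this x)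

lemma exists_smul_of_wronskian_eq_zero {v w : Fin 2 → ℂ} (h : wronskian v w = 0) (hv : v ≠ 0) :
    ∃ c : ℂ, w = c • v := by
  unfold wronskian at h
  by_cases h0 : v 0 = 0
  · have h1 : v 1 ≠ 0 := fun h1 => hv (by ext i; fin_cases i <;> simp [h0, h1])
    have hw0 : w 0 = 0 := by simpa [h0, h1] using h
    refine ⟨w 1 / v 1, ?_⟩
    ext i; fin_cases i <;> simp [h0, hw0, h1]
  · refine ⟨w 0 / v 0, ?_⟩
    ext i; fin_cases i
    · simp [h0]
    · simp only [Fin.mk_one, Fin.isValue, Pi.smul_apply, smul_eq_mul]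
      field_simp
      linear_combination h

/-- Two solutions with vanishing Wronskian are proportional. -/
lemma IsLinSol.exists_smul {B : ℝ → Matrix (Fin 2) (Fin 2) ℂ} (hB : Continuous B)
    {v w : ℝ → Fin 2 → ℂ} (hv : IsLinSol B v) (hw : IsLinSol B w) (hv0 : v ≠ 0)
    {x₀ : ℝ} (h : wronskian (v x₀) (w x₀) = 0) : ∃ c : ℂ, w = fun x => c • v x := by
  have hx : v x₀ ≠ 0 := fun h => hv0 (hv.eq_zero hB h)
  obtain ⟨c, hc⟩ := exists_smul_of_wronskian_eq_zero h hx
  exact ⟨c, hw.eq_of_eq hB (hv.smul c) hc⟩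

/-! ### Volterra integral equations on the half-line -/

/-- The tail integral `∫ₓ^∞ k` has derivative `-k`. -/
lemma hasDerivAt_integral_Ioi {E : Type*} [NormedAddCommGroup E] [NormedSpace ℝ E] [CompleteSpace E]
    {k : ℝ → E} (hk : Continuous k) (hi : ∀ x, IntegrableOn k (Set.Ioi x)) (a : ℝ) :
    HasDerivAt (fun x => ∫ y in Set.Ioi x, k y) (-k a) a := by
  have h1 : (fun x => ∫ y in Set.Ioi x, k y) =
      fun x => (∫ y in Set.Ioi a, k y) - ∫ y in a..x, k y := by
    funext x
    rw [← intervalIntegral.integral_Ioi_sub_Ioi' (hi a) (hi x), sub_sub_cancel]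
  rw [h1]
  have := (hasDerivAt_const a (∫ y in Set.Ioi a, k y)).fun_sub
    (intervalIntegral.integral_hasDerivAt_right (hk.intervalIntegrable a a)
      (hk.stronglyMeasurableAtFilter _ _) hk.continuousAt)
  simpa using this

lemma tendsto_integral_Ioi_atTop {E : Type*} [NormedAddCommGroup E] [NormedSpace ℝ E]
    {k : ℝ → E} (hi : Integrable k) :
    Tendsto (fun x => ∫ y in Set.Ioi x, k y) atTop (𝓝 0) := by
  have h := intervalIntegral_tendsto_integral_Ioi 0 hi.integrableOn tendsto_id
  have h2 := h.const_sub (∫ y in Set.Ioi 0, k y)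
  rw [sub_self] at h2
  refine h2.congr fun x => ?_
  rw [id, ← intervalIntegral.integral_Ioi_sub_Ioi' hi.integrableOn hi.integrableOn, sub_sub_cancel]

/-- `∫ₓ^∞ k exp (2 ∫_y^∞ k) dy = (exp (2 ∫ₓ^∞ k) - 1) / 2`. -/
lemma integral_Ioi_mul_exp_tail {k : ℝ → ℝ} (hk : Continuous k) (hi : Integrable k)
    (h0 : ∀ x, 0 ≤ k x) (x : ℝ) :
    IntegrableOn (fun y => k y * Real.exp (2 * ∫ r in Set.Ioi y, k r)) (Set.Ioi x) ∧
    ∫ y in Set.Ioi x, k y * Real.exp (2 * ∫ r in Set.Ioi y, k r) =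
      (Real.exp (2 * ∫ r in Set.Ioi x, k r) - 1) / 2 := by
  have hd : ∀ y ∈ Set.Ici x, HasDerivAt (fun y => -Real.exp (2 * ∫ r in Set.Ioi y, k r) / 2)
      (k y * Real.exp (2 * ∫ r in Set.Ioi y, k r)) y := fun y _ => by
    have := ((((hasDerivAt_integral_Ioi hk (fun _ => hi.integrableOn) y).const_mul 2).exp).fun_neg).div_const 2
    refine this.congr_deriv ?_
    ring
  have hp : ∀ y ∈ Set.Ioi x, 0 ≤ k y * Real.exp (2 * ∫ r in Set.Ioi y, k r) := fun y _ =>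
    mul_nonneg (h0 y) (Real.exp_pos _).le
  have hl : Tendsto (fun y => -Real.exp (2 * ∫ r in Set.Ioi y, k r) / 2) atTop (𝓝 (-1 / 2)) := by
    have := ((Real.continuous_exp.tendsto _).comp
      ((tendsto_integral_Ioi_atTop hi).const_mul 2)).neg.div_const 2
    simpa using this
  refine ⟨integrableOn_Ioi_deriv_of_nonneg' hd hp hl, ?_⟩
  rw [integral_Ioi_of_hasDerivAt_of_nonneg' hd hp hl]
  ring

/-- A Volterra equation on the half-line with integrable kernel has a bounded continuous
solution. -/
theorem exists_volterra {E : Type*} [NormedAddCommGroup E] [NormedSpace ℝ E] [CompleteSpace E]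
    {k : ℝ → ℝ} (hk : Continuous k) (hi : Integrable k) (h0 : ∀ x, 0 ≤ k x)
    {N : ℝ → ℝ → E →L[ℝ] E} (hN : Continuous fun q : ℝ × ℝ => N q.1 q.2)
    (hNk : ∀ x y, x ≤ y → ‖N x y‖ ≤ k y) (v : E) :
    ∃ m : ℝ → E, Continuous m ∧ (∃ C, ∀ x, ‖m x‖ ≤ C) ∧
      ∀ x, m x = v + ∫ y in Set.Ioi x, N x y (m y) := by
  -- The unknown is rescaled as m = exp(2κ) n. With this weight the kernel integrates to (exp(2κ) -
  -- 1)/2, so the integral operator has norm at most 1/2 in the sup norm whatever the size of k.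
  set κ : ℝ → ℝ := fun x => ∫ r in Set.Ioi x, k r with hκ
  have hκc : Continuous κ := continuous_iff_continuousAt.2 fun x =>
    (hasDerivAt_integral_Ioi hk (fun _ => hi.integrableOn) x).continuousAt
  have hκ0 : ∀ x, 0 ≤ κ x := fun x => setIntegral_nonneg measurableSet_Ioi fun y _ => h0 y
  have hW : ∀ x, IntegrableOn (fun y => k y * Real.exp (2 * κ y)) (Set.Ioi x) := fun x =>
    (integral_Ioi_mul_exp_tail hk hi h0 x).1
  have hκI : ∀ x, κ x ≤ ∫ r, k r := fun x =>
    setIntegral_le_integral hi (Eventually.of_forall h0)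
  set I : ℝ := ∫ r, k r
  -- the weighted integrand
  set g : (BoundedContinuousFunction ℝ E) → ℝ → ℝ → E :=
    fun n x y => N x y (Real.exp (2 * κ y) • n y) with hg
  have hgc : ∀ n : BoundedContinuousFunction ℝ E, Continuous fun q : ℝ × ℝ => g n q.1 q.2 := by
    intro n
    have hn := n.continuous
    exact hN.clm_apply (by fun_prop)
  have hgb : ∀ (n : BoundedContinuousFunction ℝ E) x y, x ≤ y →
      ‖g n x y‖ ≤ k y * Real.exp (2 * κ y) * ‖n‖ := by
    intro n x y hxy
    refine ((N x y).le_opNorm _).trans ?_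
    rw [norm_smul, Real.norm_of_nonneg (Real.exp_pos _).le, mul_assoc]
    gcongr
    · exact h0 y
    · exact hNk x y hxy
    · exact n.norm_coe_le_norm y
  have hgi : ∀ (n : BoundedContinuousFunction ℝ E) x, IntegrableOn (g n x) (Set.Ioi x) := by
    intro n x
    refine ((hW x).mul_const ‖n‖).mono' ?_ ?_
    · exact ((hgc n).comp (by fun_prop : Continuous fun y : ℝ => (x, y))).aestronglyMeasurable
    · exact (ae_restrict_iff' measurableSet_Ioi).2 (Eventually.of_forall fun y hy =>
        hgb n x y (le_of_lt hy))
  have hIb : ∀ (n : BoundedContinuousFunction ℝ E) x,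
      ‖∫ y in Set.Ioi x, g n x y‖ ≤ (Real.exp (2 * κ x) - 1) / 2 * ‖n‖ := by
    intro n x
    rw [← (integral_Ioi_mul_exp_tail hk hi h0 x).2, ← integral_mul_const]
    exact norm_integral_le_of_norm_le ((hW x).mul_const _)
      ((ae_restrict_iff' measurableSet_Ioi).2 (Eventually.of_forall fun y hy =>
        hgb n x y (le_of_lt hy)))
  have hwk : Integrable fun y => k y * Real.exp (2 * I) := hi.mul_const _
  have hIc : ∀ n : BoundedContinuousFunction ℝ E,
      Continuous fun x => ∫ y in Set.Ioi x, g n x y := by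
    intro n
    simp_rw [← integral_indicator measurableSet_Ioi]
    refine continuous_iff_continuousAt.2 fun x₀ => ?_
    refine continuousAt_of_dominated (bound := fun y => k y * Real.exp (2 * I) * ‖n‖)
      (Eventually.of_forall fun x => ?_) (Eventually.of_forall fun x => Eventually.of_forall
        fun y => ?_) (hwk.mul_const _) ?_
    · exact ((hgc n).comp (by fun_prop : Continuous fun y : ℝ => (x, y))).aestronglyMeasurable.indicator
        measurableSet_Ioi
    · by_cases hy : y ∈ Set.Ioi x
      · rw [Set.indicator_of_mem hy]
        refine (hgb n x y (le_of_lt hy)).trans ?_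
        gcongr
        · exact h0 y
        · exact hκI y
      · rw [Set.indicator_of_notMem hy, norm_zero]
        have := h0 y
        positivity
    -- The indicator of y > x jumps in x only at x = y, so the integrand is continuous at x₀ for
    -- every y except the null set {x₀}.
    · have : ∀ᵐ y : ℝ, y ≠ x₀ := by simp [ae_iff, measure_singleton]
      filter_upwards [this] with y hy
      rcases lt_or_gt_of_ne hy with h | h
      · refine (continuousAt_const (y := (0 : E))).congr ?_
        filter_upwards [lt_mem_nhds h] with x hx
        rw [Set.indicator_of_notMem (by simpa using hx.le)]
      · have hc : ContinuousAt (fun x => g n x y) x₀ :=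
          ((hgc n).comp (by fun_prop : Continuous fun x : ℝ => (x, y))).continuousAt
        refine hc.congr ?_
        filter_upwards [gt_mem_nhds h] with x hx
        rw [Set.indicator_of_mem (by simpa using hx)]
  have hexp : ∀ x, Real.exp (-(2 * κ x)) * Real.exp (2 * κ x) = 1 := fun x => by
    rw [← Real.exp_add]; simp
  have hexp1 : ∀ x, Real.exp (-(2 * κ x)) ≤ 1 := fun x => by
    rw [Real.exp_le_one_iff]; linarith [hκ0 x]
  have hhalf : ∀ (n : BoundedContinuousFunction ℝ E) x,
      Real.exp (-(2 * κ x)) * ‖∫ y in Set.Ioi x, g n x y‖ ≤ 1 / 2 * ‖n‖ := by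
    intro n x
    calc _ ≤ Real.exp (-(2 * κ x)) * ((Real.exp (2 * κ x) - 1) / 2 * ‖n‖) := by
          gcongr; exact hIb n x
      _ = (1 - Real.exp (-(2 * κ x))) / 2 * ‖n‖ := by linear_combination (‖n‖ / 2) * hexp x
      _ ≤ _ := by gcongr; linarith [Real.exp_pos (-(2 * κ x))]
  let Φ : BoundedContinuousFunction ℝ E → BoundedContinuousFunction ℝ E := fun n =>
    BoundedContinuousFunction.ofNormedAddCommGroup
      (fun x => Real.exp (-(2 * κ x)) • (v + ∫ y in Set.Ioi x, g n x y))
      (by have := hIc n; fun_prop) (‖v‖ + 1 / 2 * ‖n‖) (fun x => by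
        rw [norm_smul, Real.norm_of_nonneg (Real.exp_pos _).le]
        calc _ ≤ Real.exp (-(2 * κ x)) * (‖v‖ + ‖∫ y in Set.Ioi x, g n x y‖) := by
              gcongr; exact norm_add_le _ _
          _ = Real.exp (-(2 * κ x)) * ‖v‖ +
              Real.exp (-(2 * κ x)) * ‖∫ y in Set.Ioi x, g n x y‖ := by ring
          _ ≤ 1 * ‖v‖ + 1 / 2 * ‖n‖ := by
              exact add_le_add (mul_le_mul_of_nonneg_right (hexp1 x) (norm_nonneg v)) (hhalf n x)
          _ = _ := by ring)
  have hΦ : ContractingWith (1 / 2) Φ := by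
    refine ⟨by rw [← NNReal.coe_lt_coe]; norm_num, LipschitzWith.of_dist_le_mul fun n n' => ?_⟩
    rw [BoundedContinuousFunction.dist_le (by positivity)]
    intro x
    have hsub : Φ n x - Φ n' x = Real.exp (-(2 * κ x)) • ∫ y in Set.Ioi x, g (n - n') x y := by
      change Real.exp (-(2 * κ x)) • (v + ∫ y in Set.Ioi x, g n x y) -
        Real.exp (-(2 * κ x)) • (v + ∫ y in Set.Ioi x, g n' x y) = _
      rw [← smul_sub, add_sub_add_left_eq_sub, ← integral_sub (hgi n x) (hgi n' x)]
      simp only [hg, BoundedContinuousFunction.coe_sub, Pi.sub_apply, smul_sub, map_sub]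
    rw [dist_eq_norm, hsub, norm_smul, Real.norm_of_nonneg (Real.exp_pos _).le, dist_eq_norm]
    simpa using hhalf (n - n') x
  set n := ContractingWith.fixedPoint Φ hΦ
  have hfix : Φ n = n := ContractingWith.fixedPoint_isFixedPt hΦ
  refine ⟨fun x => Real.exp (2 * κ x) • n x, by have := n.continuous; fun_prop,
    ⟨Real.exp (2 * I) * ‖n‖, fun x => ?_⟩, fun x => ?_⟩
  · rw [norm_smul, Real.norm_of_nonneg (Real.exp_pos _).le]
    gcongr
    · exact hκI x
    · exact n.norm_coe_le_norm x
  · have : n x = Real.exp (-(2 * κ x)) • (v + ∫ y in Set.Ioi x, g n x y) := by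
      conv_lhs => rw [← hfix]
      rfl
    change Real.exp (2 * κ x) • n x = v + ∫ y in Set.Ioi x, g n x y
    rw [this, smul_smul, mul_comm, hexp, one_smul]

/-! ### Normalized solutions at infinity -/

/-- The coefficient matrix `lam σ₃ + A`. -/
def linCoeff (lam : ℂ) (A : ℝ → Matrix (Fin 2) (Fin 2) ℂ) (x : ℝ) : Matrix (Fin 2) (Fin 2) ℂ :=
  !![lam, 0; 0, -lam] + A x

/-- `j` solves `j' = (lam σ₃ + A) j` and `exp (∓ lam x) j(x)` tends to the `k`-th unit vector. -/
def IsNormalizedSol (lam : ℂ) (A : ℝ → Matrix (Fin 2) (Fin 2) ℂ) (k : Fin 2) (l : Filter ℝ)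
    (j : ℝ → Fin 2 → ℂ) : Prop :=
  IsLinSol (linCoeff lam A) j ∧
    Tendsto (fun x : ℝ => Complex.exp (-(sigma3 k * lam * x)) • j x) l (𝓝 (Pi.single k 1))

lemma continuous_linCoeff {lam : ℂ} {A : ℝ → Matrix (Fin 2) (Fin 2) ℂ} (hA : Continuous A) :
    Continuous (linCoeff lam A) := continuous_const.add hA

lemma linCoeff_mulVec_zero (lam : ℂ) (A : ℝ → Matrix (Fin 2) (Fin 2) ℂ) (x : ℝ) (w : Fin 2 → ℂ) :
    (linCoeff lam A x).mulVec w 0 = lam * w 0 + (A x).mulVec w 0 := by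
  simp [linCoeff, Matrix.mulVec, dotProduct, Fin.sum_univ_two]; ring

lemma linCoeff_mulVec_one (lam : ℂ) (A : ℝ → Matrix (Fin 2) (Fin 2) ℂ) (x : ℝ) (w : Fin 2 → ℂ) :
    (linCoeff lam A x).mulVec w 1 = -lam * w 1 + (A x).mulVec w 1 := by
  simp [linCoeff, Matrix.mulVec, dotProduct, Fin.sum_univ_two]; ring

/-- Multiplication of vectors by matrices, as a linear map into the bounded operators. -/
noncomputable def mulVecOp :
    Matrix (Fin 2) (Fin 2) ℂ →ₗ[ℝ] ((Fin 2 → ℂ) →L[ℝ] (Fin 2 → ℂ)) :=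
  (LinearMap.toContinuousLinearMap (𝕜 := ℝ) (E := Fin 2 → ℂ) (F' := Fin 2 → ℂ)).toLinearMap ∘ₗ
    Matrix.mulVecBilin ℝ ℝ

lemma mulVecOp_apply (M : Matrix (Fin 2) (Fin 2) ℂ) (v : Fin 2 → ℂ) :
    mulVecOp M v = M.mulVec v := rfl

lemma continuous_mulVecOp : Continuous mulVecOp :=
  LinearMap.continuous_of_finiteDimensional _

lemma norm_mulVecOp_le (M : Matrix (Fin 2) (Fin 2) ℂ) : ‖mulVecOp M‖ ≤ ‖M‖ :=
  ContinuousLinearMap.opNorm_le_bound _ (norm_nonneg _) fun v => Matrix.linfty_opNorm_mulVec M v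

lemma integrable_norm_matrix {A : ℝ → Matrix (Fin 2) (Fin 2) ℂ} (hA : Continuous A)
    (hi : ∀ i k, Integrable fun x => A x i k) : Integrable fun x => ‖A x‖ := by
  refine (((hi 0 0).norm.add (hi 0 1).norm).add ((hi 1 0).norm.add (hi 1 1).norm)).mono'
    hA.norm.aestronglyMeasurable (Eventually.of_forall fun x => ?_)
  rw [norm_norm, Matrix.linfty_opNorm_def]
  simp only [Fin.sum_univ_two, Pi.add_apply]
  rw [← NNReal.coe_mk (‖A x 0 0‖ + ‖A x 0 1‖ + (‖A x 1 0‖ + ‖A x 1 1‖)) (by positivity),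
    NNReal.coe_le_coe, Finset.sup_le_iff]
  intro i _
  rw [← NNReal.coe_le_coe]
  fin_cases i
  · simpa using by positivity
  · simpa using by positivity

theorem exists_isNormalizedSol_zero_atTop {lam : ℂ} (hlam : lam.re ≤ 0)
    {A : ℝ → Matrix (Fin 2) (Fin 2) ℂ} (hA : Continuous A)
    (hAi : ∀ i k, Integrable fun x => A x i k) :
    ∃ j, IsNormalizedSol lam A 0 atTop j := by
  have hi := integrable_norm_matrix hA hAi
  -- For m = exp(-lam x) j the system reads m₀' = (A m)₀, m₁' = -2 lam m₁ + (A m)₁. Integrating from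
  -- +∞ gives this kernel. Its exponential is bounded by 1 because lam.re ≤ 0 and y ≥ x.
  set W : ℝ → ℝ → Matrix (Fin 2) (Fin 2) ℂ := fun x y =>
    -(Matrix.diagonal ![1, Complex.exp (2 * lam * (y - x))] * A y) with hW
  have hWc : Continuous fun q : ℝ × ℝ => W q.1 q.2 := by
    have : Continuous fun q : ℝ × ℝ =>
        Matrix.diagonal ![1, Complex.exp (2 * lam * ((q.2 : ℂ) - q.1))] := by
      refine Continuous.matrix_diagonal (continuous_pi fun i => ?_)
      fin_cases i
      · exact continuous_const
      · change Continuous fun q : ℝ × ℝ => Complex.exp (2 * lam * ((q.2 : ℂ) - q.1))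
        fun_prop
    exact (this.mul (hA.comp continuous_snd)).neg
  have hexp : ∀ x y : ℝ, x ≤ y → ‖Complex.exp (2 * lam * (y - x))‖ ≤ 1 := by
    intro x y hxy
    rw [Complex.norm_exp, Real.exp_le_one_iff]
    have : (2 * lam * ((y : ℂ) - x)).re = 2 * lam.re * (y - x) := by
      simp [Complex.mul_re]
    rw [this]
    nlinarith
  have hWn : ∀ x y, x ≤ y → ‖W x y‖ ≤ ‖A y‖ := by
    intro x y hxy
    rw [hW, norm_neg]
    refine (norm_mul_le _ _).trans (mul_le_of_le_one_left (norm_nonneg _) ?_)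
    rw [Matrix.linfty_opNorm_diagonal, pi_norm_le_iff_of_nonneg zero_le_one]
    intro i
    fin_cases i
    · simp
    · simpa using hexp x y hxy
  obtain ⟨m, hmc, ⟨C, hC⟩, hm⟩ := exists_volterra (k := fun y => ‖A y‖) hA.norm hi
    (fun x => norm_nonneg _) (N := fun x y => mulVecOp (W x y))
    (continuous_mulVecOp.comp hWc) (fun x y hxy => (norm_mulVecOp_le _).trans (hWn x y hxy))
    (Pi.single 0 1)
  simp only [mulVecOp_apply] at hm
  have hF : Continuous fun y => (A y).mulVec (m y) := hA.matrix_mulVec hmc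
  have hFb : ∀ x y, x ≤ y → ‖(W x y).mulVec (m y)‖ ≤ ‖A y‖ * C := fun x y hxy =>
    (Matrix.linfty_opNorm_mulVec _ _).trans
      (mul_le_mul (hWn x y hxy) (hC y) (norm_nonneg _) (norm_nonneg _))
  have hint : ∀ x, IntegrableOn (fun y => (W x y).mulVec (m y)) (Set.Ioi x) := fun x => by
    refine (hi.mul_const C).integrableOn.mono' ?_ ?_
    · exact ((hWc.comp (by fun_prop : Continuous fun y : ℝ => (x, y))).matrix_mulVec
        hmc).aestronglyMeasurable
    · exact (ae_restrict_iff' measurableSet_Ioi).2 (Eventually.of_forall fun y hy =>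
        hFb x y (le_of_lt hy))
  have hcomp0 : ∀ x y, (W x y).mulVec (m y) 0 = -(A y).mulVec (m y) 0 := fun x y => by
    simp [hW, Matrix.neg_mulVec, ← Matrix.mulVec_mulVec]
  have hcomp1 : ∀ x y : ℝ, (W x y).mulVec (m y) 1 =
      -(Complex.exp (-(2 * lam * x)) * (Complex.exp (2 * lam * y) * (A y).mulVec (m y) 1)) :=
    fun x y => by
      rw [← mul_assoc, ← Complex.exp_add, show -(2 * lam * x) + 2 * lam * y = 2 * lam * (y - x) by
        ring]
      simp [hW, Matrix.neg_mulVec, ← Matrix.mulVec_mulVec]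
  have hi0 : ∀ x, IntegrableOn (fun y => (A y).mulVec (m y) 0) (Set.Ioi x) := fun x => by
    have := ((hint x).eval 0).neg
    simp only [hcomp0] at this
    exact this.congr (Eventually.of_forall fun y => neg_neg _)
  have hi1 : ∀ x : ℝ, IntegrableOn (fun y : ℝ => Complex.exp (2 * lam * y) * (A y).mulVec (m y) 1)
      (Set.Ioi x) := fun x => by
    have := (((hint x).eval 1).neg).const_mul (Complex.exp (2 * lam * x))
    simp only [hcomp1, Pi.neg_apply, neg_neg] at this
    simp only [← mul_assoc, ← Complex.exp_add, add_neg_cancel_left] at this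
    exact this
  have hm0 : ∀ x, m x 0 = 1 - ∫ y in Set.Ioi x, (A y).mulVec (m y) 0 := fun x => by
    rw [hm x, Pi.add_apply, eval_integral (fun i => (hint x).eval i)]
    simp only [hcomp0, integral_neg]
    simp [sub_eq_add_neg]
  have hm1 : ∀ x : ℝ, m x 1 = -(Complex.exp (-(2 * lam * x)) *
      ∫ y in Set.Ioi x, Complex.exp (2 * lam * y) * (A y).mulVec (m y) 1) := fun x => by
    rw [hm x, Pi.add_apply, eval_integral (fun i => (hint x).eval i)]
    simp only [hcomp1, integral_neg, integral_const_mul]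
    simp
  have hel : ∀ (c : ℂ) (x : ℝ), HasDerivAt (fun x : ℝ => Complex.exp (c * x))
      (c * Complex.exp (c * x)) x := fun c x => by
    have := ((hasDerivAt_id (x : ℂ)).const_mul c).cexp.comp_ofReal
    simpa [mul_comm] using this
  have hd0 : ∀ x, HasDerivAt (fun x => m x 0) ((A x).mulVec (m x) 0) x := fun x => by
    have := (hasDerivAt_integral_Ioi ((continuous_apply 0).comp hF) hi0 x).const_sub 1
    simp only [Function.comp_def] at this
    rw [← funext hm0] at this
    simpa using this
  have hd1 : ∀ x, HasDerivAt (fun x => m x 1) (-(2 * lam) * m x 1 + (A x).mulVec (m x) 1) x :=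
    fun x => by
      have hc : Continuous fun y : ℝ => Complex.exp (2 * lam * y) * (A y).mulVec (m y) 1 :=
        (by fun_prop : Continuous fun y : ℝ => Complex.exp (2 * lam * y)).mul
          ((continuous_apply 1).comp hF)
      have := ((hel (-(2 * lam)) x).fun_mul (hasDerivAt_integral_Ioi hc hi1 x)).fun_neg
      simp only [neg_mul] at this
      rw [← funext hm1] at this
      refine this.congr_deriv ?_
      rw [hm1 x]
      have h1 : Complex.exp (-(2 * lam * x)) * Complex.exp (2 * lam * x) = 1 := by
        rw [← Complex.exp_add]; simp
      linear_combination ((A x).mulVec (m x) 1) * h1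
  refine ⟨fun x => Complex.exp (lam * x) • m x, fun x => ?_, ?_⟩
  · rw [hasDerivAt_pi, Fin.forall_fin_two]
    constructor
    · have := (hel lam x).fun_mul (hd0 x)
      rw [linCoeff_mulVec_zero, Matrix.mulVec_smul]
      refine this.congr_deriv ?_
      simp only [Pi.smul_apply, smul_eq_mul]; ring
    · have := (hel lam x).fun_mul (hd1 x)
      rw [linCoeff_mulVec_one, Matrix.mulVec_smul]
      refine this.congr_deriv ?_
      simp only [Pi.smul_apply, smul_eq_mul]; ring
  · have hlim : Tendsto m atTop (𝓝 (Pi.single 0 1)) := by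
      have h1 := tendsto_integral_Ioi_atTop (hi.mul_const C)
      rw [tendsto_iff_norm_sub_tendsto_zero]
      refine squeeze_zero (fun x => norm_nonneg _) (fun x => ?_) h1
      rw [hm x, add_sub_cancel_left]
      exact norm_integral_le_of_norm_le (hi.mul_const C).integrableOn
        ((ae_restrict_iff' measurableSet_Ioi).2 (Eventually.of_forall fun y hy =>
          hFb x y (le_of_lt hy)))
    refine hlim.congr fun x => ?_
    rw [smul_smul, ← Complex.exp_add]
    simp [sigma3]

/-- Exchanging the two components conjugates σ₃ into -σ₃. With the reflection x ↦ -x below, it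
reduces the four existence statements to a single one. -/
lemma IsNormalizedSol.swap {lam : ℂ} {A : ℝ → Matrix (Fin 2) (Fin 2) ℂ} {l : Filter ℝ}
    {j : ℝ → Fin 2 → ℂ}
    (h : IsNormalizedSol (-lam) (fun x => !![A x 1 1, A x 1 0; A x 0 1, A x 0 0]) 0 l j) :
    IsNormalizedSol lam A 1 l (fun x => ![j x 1, j x 0]) := by
  refine ⟨fun x => ?_, ?_⟩
  · have h1 := hasDerivAt_pi.1 (h.1 x)
    rw [hasDerivAt_pi, Fin.forall_fin_two]
    constructor
    · refine (h1 1).congr_deriv ?_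
      simp [linCoeff, Matrix.mulVec, dotProduct, Fin.sum_univ_two]
      ring
    · refine (h1 0).congr_deriv ?_
      simp [linCoeff, Matrix.mulVec, dotProduct, Fin.sum_univ_two]
      ring
  · have h2 := tendsto_pi_nhds.1 h.2
    rw [tendsto_pi_nhds, Fin.forall_fin_two]
    constructor
    · simpa [sigma3] using h2 1
    · simpa [sigma3] using h2 0

lemma IsNormalizedSol.reflect {lam : ℂ} {A : ℝ → Matrix (Fin 2) (Fin 2) ℂ} {k : Fin 2}
    {j : ℝ → Fin 2 → ℂ} (h : IsNormalizedSol (-lam) (fun x => -A (-x)) k atTop j) :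
    IsNormalizedSol lam A k atBot (fun x => j (-x)) := by
  refine ⟨fun x => ?_, ?_⟩
  · have h1 := (h.1 (-x)).scomp x (hasDerivAt_neg x)
    refine h1.congr_deriv ?_
    rw [neg_smul, one_smul, ← Matrix.neg_mulVec]
    congr 1
    ext i k
    fin_cases i <;> fin_cases k <;> simp [linCoeff, add_comm]
  · have h2 := h.2.comp tendsto_neg_atBot_atTop
    refine h2.congr fun x => ?_
    simp

theorem exists_isNormalizedSol_one_atTop {lam : ℂ} (hlam : 0 ≤ lam.re)
    {A : ℝ → Matrix (Fin 2) (Fin 2) ℂ} (hA : Continuous A)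
    (hAi : ∀ i k, Integrable fun x => A x i k) :
    ∃ j, IsNormalizedSol lam A 1 atTop j := by
  obtain ⟨j, hj⟩ := exists_isNormalizedSol_zero_atTop (lam := -lam) (by simpa using hlam)
    (A := fun x => !![A x 1 1, A x 1 0; A x 0 1, A x 0 0])
    (continuous_matrix fun i k => by
      fin_cases i <;> fin_cases k
      · exact hA.matrix_elem 1 1
      · exact hA.matrix_elem 1 0
      · exact hA.matrix_elem 0 1
      · exact hA.matrix_elem 0 0)
    (fun i k => by
      fin_cases i <;> fin_cases k
      · exact hAi 1 1
      · exact hAi 1 0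
      · exact hAi 0 1
      · exact hAi 0 0)
  exact ⟨_, hj.swap⟩

theorem exists_isNormalizedSol_zero_atBot {lam : ℂ} (hlam : 0 ≤ lam.re)
    {A : ℝ → Matrix (Fin 2) (Fin 2) ℂ} (hA : Continuous A)
    (hAi : ∀ i k, Integrable fun x => A x i k) :
    ∃ j, IsNormalizedSol lam A 0 atBot j := by
  obtain ⟨j, hj⟩ := exists_isNormalizedSol_zero_atTop (lam := -lam) (by simpa using hlam)
    (A := fun x => -A (-x)) (hA.comp continuous_neg).neg (fun i k => (hAi i k).comp_neg.neg)
  exact ⟨_, hj.reflect⟩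

theorem exists_isNormalizedSol_one_atBot {lam : ℂ} (hlam : lam.re ≤ 0)
    {A : ℝ → Matrix (Fin 2) (Fin 2) ℂ} (hA : Continuous A)
    (hAi : ∀ i k, Integrable fun x => A x i k) :
    ∃ j, IsNormalizedSol lam A 1 atBot j := by
  obtain ⟨j, hj⟩ := exists_isNormalizedSol_one_atTop (lam := -lam) (by simpa using hlam)
    (A := fun x => -A (-x)) (hA.comp continuous_neg).neg (fun i k => (hAi i k).comp_neg.neg)
  exact ⟨_, hj.reflect⟩

/-! ### Wronskians, uniqueness and size of normalized solutions -/

lemma wronskian_smul_smul (a b : ℂ) (v w : Fin 2 → ℂ) :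
    wronskian (a • v) (b • w) = a * b * wronskian v w := by
  simp [wronskian]; ring

lemma continuous_wronskian : Continuous fun q : (Fin 2 → ℂ) × (Fin 2 → ℂ) => wronskian q.1 q.2 := by
  unfold wronskian; fun_prop

lemma linCoeff_trace {lam : ℂ} {A : ℝ → Matrix (Fin 2) (Fin 2) ℂ}
    (hA : ∀ x, A x 0 0 + A x 1 1 = 0) (x : ℝ) :
    linCoeff lam A x 0 0 + linCoeff lam A x 1 1 = 0 := by
  simp [linCoeff]; linear_combination hA x

lemma IsNormalizedSol.ne_zero {lam : ℂ} {A : ℝ → Matrix (Fin 2) (Fin 2) ℂ} {k : Fin 2}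
    {l : Filter ℝ} [l.NeBot] {j : ℝ → Fin 2 → ℂ} (h : IsNormalizedSol lam A k l j) : j ≠ 0 := by
  rintro rfl
  have h1 : Tendsto (fun _ : ℝ => (0 : Fin 2 → ℂ)) l (𝓝 (Pi.single k 1)) := by simpa using h.2
  simpa using congrFun (tendsto_nhds_unique h1 tendsto_const_nhds) k

/-- A normalized solution which does not grow faster than allowed is unique. -/
lemma IsNormalizedSol.unique {lam : ℂ} {A : ℝ → Matrix (Fin 2) (Fin 2) ℂ} (hA : Continuous A)
    (htr : ∀ x, A x 0 0 + A x 1 1 = 0) {k : Fin 2} {l : Filter ℝ} [l.NeBot]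
    (hl : ∀ᶠ x : ℝ in l, (sigma3 k * lam * x).re ≤ 0)
    {j j' : ℝ → Fin 2 → ℂ} (h : IsNormalizedSol lam A k l j) (h' : IsNormalizedSol lam A k l j') :
    j = j' := by
  have hw := h.1.wronskian_eq (linCoeff_trace htr) h'.1
  have hlim := (continuous_wronskian.tendsto _).comp (h.2.prodMk_nhds h'.2)
  have hz : wronskian (Pi.single k 1) (Pi.single k 1) = 0 := by simp [wronskian]; ring
  simp only [Function.comp_def, wronskian_smul_smul, hz] at hlim
  have h0 : wronskian (j 0) (j' 0) = 0 := by
    have := hlim.norm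
    rw [norm_zero] at this
    rw [← norm_le_zero_iff]
    refine ge_of_tendsto this ?_
    filter_upwards [hl] with x hx
    -- The Wronskian is constant, and it is multiplied here by a factor of modulus at least 1. The
    -- product tends to the Wronskian of a unit vector with itself, which is 0, so the constant is
    -- 0.
    rw [hw x 0, norm_mul, norm_mul, Complex.norm_exp]
    refine le_mul_of_one_le_left (norm_nonneg _) (one_le_mul_of_one_le_of_one_le ?_ ?_) <;>
    · rw [Real.one_le_exp_iff, Complex.neg_re]; linarith
  obtain ⟨c, rfl⟩ := h.1.exists_smul (continuous_linCoeff hA) h'.1 h.ne_zero h0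
  have h1 := h.2.const_smul c
  have h2 := tendsto_nhds_unique (h'.2.congr fun x => smul_comm _ _ _) h1
  have : c = 1 := by simpa using (congrFun h2 k).symm
  simp [this]

/-- Normalized solutions stay bounded near the end at which they are normalized. -/
lemma IsNormalizedSol.eventually_norm_le {lam : ℂ} {A : ℝ → Matrix (Fin 2) (Fin 2) ℂ}
    {k : Fin 2} {l : Filter ℝ} (hl : ∀ᶠ x : ℝ in l, (sigma3 k * lam * x).re ≤ 0)
    {j : ℝ → Fin 2 → ℂ} (h : IsNormalizedSol lam A k l j) : ∀ᶠ x in l, ‖j x‖ ≤ 2 := by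
  have h1 := h.2.norm
  have h2 : ‖(Pi.single k 1 : Fin 2 → ℂ)‖ < 2 := by rw [Pi.norm_single]; norm_num
  filter_upwards [hl, h1.eventually (gt_mem_nhds h2)] with x hx hx2
  rw [norm_smul, Complex.norm_exp] at hx2
  refine le_trans (le_mul_of_one_le_left (norm_nonneg _) ?_) hx2.le
  rw [Real.one_le_exp_iff, Complex.neg_re]; linarith

/-- The two normalizing exponentials are inverse to each other, so the constant Wronskian equals its
limit, the determinant of the unit vectors. -/
lemma IsNormalizedSol.wronskian_eq_one {lam : ℂ} {A : ℝ → Matrix (Fin 2) (Fin 2) ℂ}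
    (htr : ∀ x, A x 0 0 + A x 1 1 = 0) {l : Filter ℝ} [l.NeBot] {j j' : ℝ → Fin 2 → ℂ}
    (h : IsNormalizedSol lam A 0 l j) (h' : IsNormalizedSol lam A 1 l j') (x : ℝ) :
    wronskian (j x) (j' x) = 1 := by
  have hw := h.1.wronskian_eq (linCoeff_trace htr) h'.1
  have hlim := (continuous_wronskian.tendsto _).comp (h.2.prodMk_nhds h'.2)
  have hz : wronskian (Pi.single 0 1) (Pi.single 1 1) = 1 := by simp [wronskian]
  simp only [Function.comp_def, wronskian_smul_smul, hz] at hlim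
  refine tendsto_nhds_unique (f := fun _ : ℝ => wronskian (j x) (j' x)) tendsto_const_nhds
    (hlim.congr fun y => ?_)
  rw [← Complex.exp_add, hw y x]
  simp [sigma3]

/-- A square-integrable function is not bounded below near `±∞`. -/
lemma not_eventually_le_norm_of_memLp {E : Type*} [NormedAddCommGroup E] {f : ℝ → E}
    (hf : MemLp f 2) {c : ℝ} (hc : 0 < c) {l : Filter ℝ} (hl : l = atTop ∨ l = atBot) :
    ¬ ∀ᶠ x in l, c ≤ ‖f x‖ := by
  intro h
  have h1 := hf.meas_ge_lt_top (ε := c.toNNReal) (by norm_num) (by norm_num)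
    (by simpa using hc)
  refine h1.ne (top_unique ?_)
  rcases hl with rfl | rfl
  · obtain ⟨a, ha⟩ := eventually_atTop.1 h
    rw [← Real.volume_Ici (a := a)]
    exact measure_mono fun x hx => Real.toNNReal_le_iff_le_coe.2 (ha x hx)
  · obtain ⟨a, ha⟩ := eventually_atBot.1 h
    rw [← Real.volume_Iic (a := a)]
    exact measure_mono fun x hx => Real.toNNReal_le_iff_le_coe.2 (ha x hx)

lemma norm_wronskian_le (v w : Fin 2 → ℂ) : ‖wronskian v w‖ ≤ 2 * (‖v‖ * ‖w‖) := by
  unfold wronskian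
  calc _ ≤ ‖v 0 * w 1‖ + ‖v 1 * w 0‖ := norm_sub_le _ _
    _ = ‖v 0‖ * ‖w 1‖ + ‖v 1‖ * ‖w 0‖ := by rw [norm_mul, norm_mul]
    _ ≤ ‖v‖ * ‖w‖ + ‖v‖ * ‖w‖ := by gcongr <;> exact norm_le_pi_norm _ _
    _ = _ := by ring

/-- A square-integrable solution is proportional to every normalized solution which stays bounded
near the end at which it is normalized. -/
lemma IsNormalizedSol.exists_eq_smul_of_memLp {lam : ℂ} {A : ℝ → Matrix (Fin 2) (Fin 2) ℂ}
    (hA : Continuous A) (htr : ∀ x, A x 0 0 + A x 1 1 = 0) {k : Fin 2} {l : Filter ℝ}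
    (hl' : l = atTop ∨ l = atBot) (hl : ∀ᶠ x : ℝ in l, (sigma3 k * lam * x).re ≤ 0)
    {j w : ℝ → Fin 2 → ℂ} (h : IsNormalizedSol lam A k l j) (hw : IsLinSol (linCoeff lam A) w)
    (hw2 : MemLp w 2) : ∃ c : ℂ, w = fun x => c • j x := by
  have : l.NeBot := by rcases hl' with rfl | rfl <;> infer_instance
  refine h.1.exists_smul (continuous_linCoeff hA) hw h.ne_zero (x₀ := 0) ?_
  by_contra h0
  -- A nonzero Wronskian W keeps w away from zero: |W| ≤ 2 ‖j‖ ‖w‖ and ‖j‖ ≤ 2 near the end, hence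
  -- ‖w‖ ≥ |W| / 4.
  refine not_eventually_le_norm_of_memLp hw2 (c := ‖wronskian (j 0) (w 0)‖ / 4)
    (by have := norm_pos_iff.2 h0; positivity) hl' ?_
  filter_upwards [h.eventually_norm_le hl] with x hx
  rw [h.1.wronskian_eq (linCoeff_trace htr) hw 0 x]
  have := norm_wronskian_le (j x) (w x)
  nlinarith [norm_nonneg (w x)]

/-! ### Propagators -/

/-- The linear system `w' = M w` with traceless `M` has a unimodular propagator on `[0, τ]`. -/
theorem exists_propagator {M : ℝ → Matrix (Fin 2) (Fin 2) ℂ} (hM : Continuous M)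
    (htr : ∀ s, M s 0 0 + M s 1 1 = 0) (τ : ℝ) :
    ∃ T : ℝ → Matrix (Fin 2) (Fin 2) ℂ, T 0 = 1 ∧ (∀ s, (T s).det = 1) ∧
      ∀ s ∈ Set.Icc 0 τ, ∀ v, HasDerivAt (fun s => (T s).mulVec v)
        ((M s).mulVec ((T s).mulVec v)) s := by
  -- A cutoff equal to 1 on [0, τ] and supported in [-1, τ + 1] makes the coefficients integrable.
  -- The normalized solutions with lam = 0 then form a fundamental matrix of determinant 1.
  set χ : ℝ → ℂ := fun s => ((max 0 (1 - max 0 (max (-s) (s - τ))) : ℝ) : ℂ) with hχ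
  have hχc : Continuous χ := by fun_prop
  have hχ1 : ∀ s ∈ Set.Icc 0 τ, χ s = 1 := fun s hs => by
    have h1 : max (-s) (s - τ) ≤ 0 := max_le (by linarith [hs.1]) (by linarith [hs.2])
    simp [hχ, max_eq_left h1]
  have hχs : HasCompactSupport χ := by
    refine HasCompactSupport.intro (isCompact_Icc (a := -1) (b := τ + 1)) fun s hs => ?_
    have : 1 ≤ max (-s) (s - τ) := by
      by_contra! h
      rw [max_lt_iff] at h
      exact hs ⟨by linarith [h.1], by linarith [h.2]⟩
    have h2 : max 0 (1 - max 0 (max (-s) (s - τ))) = 0 :=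
      max_eq_left (by linarith [le_max_right 0 (max (-s) (s - τ))])
    simp [hχ, h2]
  set A : ℝ → Matrix (Fin 2) (Fin 2) ℂ := fun s => χ s • M s with hAd
  have hA : Continuous A := hχc.smul hM
  have hAi : ∀ i k, Integrable fun s => A s i k := fun i k =>
    (hχc.mul (hM.matrix_elem i k)).integrable_of_hasCompactSupport hχs.mul_right
  have hAtr : ∀ s, A s 0 0 + A s 1 1 = 0 := fun s => by
    simp only [hAd, Matrix.smul_apply, smul_eq_mul]; linear_combination χ s * htr s
  obtain ⟨j₀, h0⟩ := exists_isNormalizedSol_zero_atTop (lam := 0) (by simp) hA hAi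
  obtain ⟨j₁, h1⟩ := exists_isNormalizedSol_one_atTop (lam := 0) (by simp) hA hAi
  set Φ : ℝ → Matrix (Fin 2) (Fin 2) ℂ := fun s => !![j₀ s 0, j₁ s 0; j₀ s 1, j₁ s 1] with hΦ
  have hdet : ∀ s, (Φ s).det = 1 := fun s => by
    rw [Matrix.det_fin_two_of, ← h0.wronskian_eq_one hAtr h1 s, wronskian]; ring
  have hΦv : ∀ s v, (Φ s).mulVec v = v 0 • j₀ s + v 1 • j₁ s := fun s v => by
    ext i
    fin_cases i <;> simp [hΦ, Matrix.mulVec, dotProduct, Fin.sum_univ_two] <;> ring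
  refine ⟨fun s => Φ s * (Φ 0)⁻¹, Matrix.mul_nonsing_inv _ (by rw [hdet]; exact isUnit_one),
    fun s => ?_, fun s hs v => ?_⟩
  · rw [Matrix.det_mul, Matrix.det_nonsing_inv, hdet, hdet]; simp
  · simp only [← Matrix.mulVec_mulVec]
    generalize (Φ 0)⁻¹.mulVec v = c
    simp only [hΦv]
    refine (((h0.1.smul (c 0)).add (h1.1.smul (c 1))) s).congr_deriv ?_
    congr 1
    simp [linCoeff, hAd, hχ1 s hs]
    ext i k; fin_cases i <;> fin_cases k <;> simp

/-! ### Dependence of linear systems on a parameter -/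

/-- Grönwall's inequality in a cruder form uniform on the interval; K ≥ 1 lets η / K be replaced by
η. -/
lemma norm_le_mul_exp_of_deriv_le {E : Type*} [NormedAddCommGroup E] [NormedSpace ℝ E]
    {f f' : ℝ → E} {K η τ : ℝ} (hK : 1 ≤ K) (hη : 0 ≤ η)
    (hf : ∀ s ∈ Set.Icc 0 τ, HasDerivAt f (f' s) s)
    (hb : ∀ s ∈ Set.Icc 0 τ, ‖f' s‖ ≤ K * ‖f s‖ + η) {s : ℝ} (hs : s ∈ Set.Icc 0 τ) :
    ‖f s‖ ≤ (‖f 0‖ + η) * Real.exp (K * τ) := by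
  have h := norm_le_gronwallBound_of_norm_deriv_right_le (f := f) (f' := f') (δ := ‖f 0‖) (K := K)
    (ε := η) (a := 0) (b := τ) (fun s hs => (hf s hs).continuousAt.continuousWithinAt)
    (fun s hs => (hf s ⟨hs.1, hs.2.le⟩).hasDerivWithinAt) le_rfl
    (fun s hs => hb s ⟨hs.1, hs.2.le⟩) s hs
  refine h.trans ?_
  rw [gronwallBound_of_K_ne_0 (by positivity), sub_zero, add_mul]
  have he : Real.exp (K * s) ≤ Real.exp (K * τ) := Real.exp_le_exp.2 (by nlinarith [hs.2])
  have h1 : η / K ≤ η := div_le_self hη hK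
  have h2 : 0 ≤ η / K := by positivity
  have h3 := Real.exp_pos (K * s)
  nlinarith [norm_nonneg (f 0)]

lemma eventually_forall_norm_sub_le {E : Type*} [NormedAddCommGroup E] {N : ℝ → ℝ → E}
    (hN : Continuous fun q : ℝ × ℝ => N q.1 q.2) (c τ : ℝ) {δ : ℝ} (hδ : 0 < δ) :
    ∀ᶠ h in 𝓝 c, ∀ s ∈ Set.Icc 0 τ, ‖N h s - N c s‖ ≤ δ := by
  refine isCompact_Icc.eventually_forall_of_forall_eventually fun s _ => ?_
  have hc : Continuous fun q : ℝ × ℝ => ‖N q.1 q.2 - N c q.2‖ :=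
    (hN.sub (hN.comp (by fun_prop : Continuous fun q : ℝ × ℝ => (c, q.2)))).norm
  have := hc.tendsto (c, s)
  simp only [sub_self, norm_zero] at this
  filter_upwards [this.eventually (gt_mem_nhds hδ)] with q hq using hq.le

/-- The mean value inequality for M(·, s) minus its linear part, whose derivative N(·, s) - N(c, s)
is small uniformly in s by compactness. -/
lemma eventually_forall_norm_sub_sub_le {E : Type*} [NormedAddCommGroup E] [NormedSpace ℝ E]
    {M N : ℝ → ℝ → E} (hN : Continuous fun q : ℝ × ℝ => N q.1 q.2)
    (hMN : ∀ c s, HasDerivAt (fun c => M c s) (N c s) c) (c τ : ℝ) {δ : ℝ} (hδ : 0 < δ) :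
    ∀ᶠ h in 𝓝 c, ∀ s ∈ Set.Icc 0 τ, ‖M h s - M c s - (h - c) • N c s‖ ≤ δ * |h - c| := by
  obtain ⟨r, hr, hb⟩ := Metric.eventually_nhds_iff_ball.1 (eventually_forall_norm_sub_le hN c τ hδ)
  filter_upwards [Metric.ball_mem_nhds c hr] with h hh s hs
  have hd : ∀ x ∈ Metric.ball c r, HasDerivWithinAt (fun x => M x s - x • N c s)
      (N x s - N c s) (Metric.ball c r) x := fun x _ => by
    have := (hMN x s).fun_sub ((hasDerivAt_id x).smul_const (N c s))
    rw [one_smul] at this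
    exact this.hasDerivWithinAt
  have := (convex_ball c r).norm_image_sub_le_of_norm_hasDerivWithin_le hd
    (fun x hx => hb x hx s hs) (Metric.mem_ball_self hr) hh
  rw [Real.norm_eq_abs] at this
  convert this using 2
  rw [sub_smul]; abel

/-- Solutions of a linear system depending differentiably on a parameter `c` are differentiable
with respect to `c` if they are initially, and the derivative is the solution `q` of the linearized
equation. -/
theorem hasDerivAt_param {M N : ℝ → ℝ → Matrix (Fin 2) (Fin 2) ℂ} {a : ℝ → ℝ → Fin 2 → ℂ}
    {q : ℝ → Fin 2 → ℂ} {c τ : ℝ}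
    (hM : Continuous fun p : ℝ × ℝ => M p.1 p.2) (hN : Continuous fun p : ℝ × ℝ => N p.1 p.2)
    (hMN : ∀ c s, HasDerivAt (fun c => M c s) (N c s) c)
    (ha : ∀ c, ∀ s ∈ Set.Icc 0 τ, HasDerivAt (a c) ((M c s).mulVec (a c s)) s)
    (hq : ∀ s ∈ Set.Icc 0 τ, HasDerivAt q ((N c s).mulVec (a c s) + (M c s).mulVec (q s)) s)
    (h0 : HasDerivAt (fun c => a c 0) (q 0) c) {s : ℝ} (hs : s ∈ Set.Icc 0 τ) :
    HasDerivAt (fun c => a c s) (q s) c := by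
  have bound : ∀ {f : ℝ → Fin 2 → ℂ}, ContinuousOn f (Set.Icc 0 τ) →
      ∃ C, 0 ≤ C ∧ ∀ s ∈ Set.Icc 0 τ, ‖f s‖ ≤ C := fun hf => by
    obtain ⟨C, hC⟩ := isCompact_Icc.exists_bound_of_continuousOn hf
    exact ⟨C, (norm_nonneg _).trans (hC s hs), hC⟩
  obtain ⟨Ca, hCa0, hCa⟩ := bound fun s hs => (ha c s hs).continuousAt.continuousWithinAt
  obtain ⟨Cq, hCq0, hCq⟩ := bound fun s hs => (hq s hs).continuousAt.continuousWithinAt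
  obtain ⟨K₀, hK₀⟩ := isCompact_Icc.exists_bound_of_continuousOn
    (hM.comp (by fun_prop : Continuous fun s : ℝ => (c, s))).continuousOn (s := Set.Icc 0 τ)
  set K := max (K₀ + 1) 1
  set B := (1 + (Ca + Cq)) * Real.exp (K * τ) with hB
  have hBpos : 0 < B := by positivity
  rw [hasDerivAt_iff_isLittleO, Asymptotics.isLittleO_iff]
  intro ε hε
  set δ := ε / B with hδ
  have hδ0 : 0 < δ := by positivity
  have hini := (Asymptotics.isLittleO_iff.1 (hasDerivAt_iff_isLittleO.1 h0)) hδ0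
  filter_upwards [hini, eventually_forall_norm_sub_le hM c τ hδ0,
    eventually_forall_norm_sub_le hM c τ one_pos,
    eventually_forall_norm_sub_sub_le hN hMN c τ hδ0] with h h1 h2 h3 h4
  -- The first order Taylor remainder in c solves the linear system with coefficients M h and a
  -- source of size δ |h - c|. Grönwall then bounds it by δ B |h - c|, and δ was chosen so that δ B
  -- = ε.
  set F : ℝ → Fin 2 → ℂ := fun s => a h s - a c s - (h - c) • q s with hF
  have hFd : ∀ s ∈ Set.Icc 0 τ, HasDerivAt F ((M h s).mulVec (F s) +
      ((M h s - M c s - (h - c) • N c s).mulVec (a c s) +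
        (h - c) • (M h s - M c s).mulVec (q s))) s := fun s hs => by
    refine (((ha h s hs).fun_sub (ha c s hs)).fun_sub ((hq s hs).const_smul (h - c))).congr_deriv ?_
    simp only [hF, Matrix.mulVec_sub, Matrix.sub_mulVec, Matrix.mulVec_smul, smul_sub, smul_add,
      Matrix.smul_mulVec]
    abel
  have hFb : ∀ s ∈ Set.Icc 0 τ, ‖(M h s).mulVec (F s) +
      ((M h s - M c s - (h - c) • N c s).mulVec (a c s) +
        (h - c) • (M h s - M c s).mulVec (q s))‖ ≤ K * ‖F s‖ + δ * |h - c| * (Ca + Cq) := by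
    intro s hs
    have hMb : ‖M h s‖ ≤ K := by
      have e1 := hK₀ s hs
      have e2 := h3 s hs
      have e3 := norm_le_norm_add_norm_sub (M c s) (M h s)
      rw [norm_sub_rev] at e3
      refine le_trans ?_ (le_max_left _ _)
      simp only [Function.comp_apply] at e1
      linarith
    have t1 := Matrix.linfty_opNorm_mulVec (M h s) (F s)
    have t2 := Matrix.linfty_opNorm_mulVec (M h s - M c s - (h - c) • N c s) (a c s)
    have t3 := Matrix.linfty_opNorm_mulVec (M h s - M c s) (q s)
    have t4 : ‖M h s - M c s - (h - c) • N c s‖ * ‖a c s‖ ≤ δ * |h - c| * Ca :=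
      mul_le_mul (h4 s hs) (hCa s hs) (norm_nonneg _) (by positivity)
    have t5 : ‖M h s - M c s‖ * ‖q s‖ ≤ δ * Cq :=
      mul_le_mul (h2 s hs) (hCq s hs) (norm_nonneg _) (by positivity)
    have t6 : ‖M h s‖ * ‖F s‖ ≤ K * ‖F s‖ := by gcongr
    calc _ ≤ ‖(M h s).mulVec (F s)‖ + (‖(M h s - M c s - (h - c) • N c s).mulVec (a c s)‖ +
          ‖(h - c) • (M h s - M c s).mulVec (q s)‖) :=
          (norm_add_le _ _).trans (add_le_add le_rfl (norm_add_le _ _))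
      _ ≤ K * ‖F s‖ + (δ * |h - c| * Ca + |h - c| * (δ * Cq)) := by
          refine add_le_add (t1.trans t6) (add_le_add (t2.trans t4) ?_)
          rw [norm_smul, Real.norm_eq_abs]
          exact mul_le_mul_of_nonneg_left (t3.trans t5) (abs_nonneg _)
      _ = _ := by ring
  have := norm_le_mul_exp_of_deriv_le (le_max_right _ _) (by positivity) hFd hFb hs
  refine this.trans ?_
  have h1' : ‖F 0‖ ≤ δ * |h - c| := by simpa [hF] using h1
  calc _ ≤ (δ * |h - c| + δ * |h - c| * (Ca + Cq)) * Real.exp (K * τ) := by gcongr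
    _ = δ * B * |h - c| := by rw [hB]; ring
    _ = ε * ‖h - c‖ := by rw [hδ, div_mul_cancel₀ _ hBpos.ne', Real.norm_eq_abs]

/-- Version of `hasDerivAt_param` with data at the right end of the interval. -/
theorem hasDerivAt_param_right {M N : ℝ → ℝ → Matrix (Fin 2) (Fin 2) ℂ} {a : ℝ → ℝ → Fin 2 → ℂ}
    {q : ℝ → Fin 2 → ℂ} {c τ : ℝ}
    (hM : Continuous fun p : ℝ × ℝ => M p.1 p.2) (hN : Continuous fun p : ℝ × ℝ => N p.1 p.2)
    (hMN : ∀ c s, HasDerivAt (fun c => M c s) (N c s) c)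
    (ha : ∀ c, ∀ s ∈ Set.Icc 0 τ, HasDerivAt (a c) ((M c s).mulVec (a c s)) s)
    (hq : ∀ s ∈ Set.Icc 0 τ, HasDerivAt q ((N c s).mulVec (a c s) + (M c s).mulVec (q s)) s)
    (h0 : HasDerivAt (fun c => a c τ) (q τ) c) {s : ℝ} (hs : s ∈ Set.Icc 0 τ) :
    HasDerivAt (fun c => a c s) (q s) c := by
  -- The substitution s ↦ τ - s changes the sign of both coefficient families and moves the data to
  -- the left end.
  have hrev : ∀ {f : ℝ → Fin 2 → ℂ} {f' : Fin 2 → ℂ} {s : ℝ}, HasDerivAt f f' (τ - s) →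
      HasDerivAt (fun s => f (τ - s)) (-f') s := fun {f f' s} hf => by
    have := hf.scomp s ((hasDerivAt_id s).const_sub τ)
    simpa [Function.comp_def] using this
  have hmem : ∀ {s}, s ∈ Set.Icc 0 τ → τ - s ∈ Set.Icc 0 τ := fun hs =>
    ⟨by linarith [hs.2], by linarith [hs.1]⟩
  have hφ : Continuous fun p : ℝ × ℝ => (p.1, τ - p.2) := by fun_prop
  have := hasDerivAt_param (M := fun c s => -M c (τ - s)) (N := fun c s => -N c (τ - s))
    (a := fun c s => a c (τ - s)) (q := fun s => q (τ - s)) (c := c) (τ := τ) (s := τ - s)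
    (hM.comp hφ).neg (hN.comp hφ).neg (fun c s => (hMN c (τ - s)).neg)
    (fun c s hs => by rw [Matrix.neg_mulVec]; exact hrev (ha c _ (hmem hs)))
    (fun s hs => by
      rw [Matrix.neg_mulVec, Matrix.neg_mulVec, ← neg_add]; exact hrev (hq _ (hmem hs)))
    (by simpa using h0) (hmem hs)
  simpa using this

/-- Asymptotics in the parameter `c`, when the coefficients converge to a constant matrix. -/
theorem tendsto_param {M : ℝ → ℝ → Matrix (Fin 2) (Fin 2) ℂ} {a : ℝ → ℝ → Fin 2 → ℂ} {τ K : ℝ}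
    (hτ : 0 ≤ τ) (hK : 1 ≤ K)
    (hM : Continuous fun p : ℝ × ℝ => M p.1 p.2)
    (hMK : ∀ c, ∀ s ∈ Set.Icc 0 τ, ‖M c s‖ ≤ K)
    (ha : ∀ c, ∀ s ∈ Set.Icc 0 τ, HasDerivAt (a c) ((M c s).mulVec (a c s)) s)
    {l : Filter ℝ} [l.IsCountablyGenerated] {D : Matrix (Fin 2) (Fin 2) ℂ}
    (hD : ∀ s ∈ Set.Icc 0 τ, Tendsto (fun c => M c s) l (𝓝 D))
    {e : Fin 2 → ℂ} {d : ℂ} (he : D.mulVec e = d • e) {f : ℝ → ℂ}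
    (h0 : Tendsto (fun c => f c • a c 0) l (𝓝 e)) :
    Tendsto (fun c => f c • a c τ) l (𝓝 (Complex.exp (d * τ) • e)) := by
  set g : ℝ → Fin 2 → ℂ := fun s => Complex.exp (d * s) • e with hg
  have hgc : Continuous g := by fun_prop
  have hgd : ∀ s, HasDerivAt g (D.mulVec (g s)) s := fun s => by
    have := (((hasDerivAt_id (s : ℂ)).const_mul d).cexp.comp_ofReal).smul_const e
    refine this.congr_deriv ?_
    rw [hg, Matrix.mulVec_smul, he, smul_smul]; simp
  set r : ℝ → ℝ → Fin 2 → ℂ := fun c s => (M c s - D).mulVec (g s) with hr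
  have hrc : Continuous fun p : ℝ × ℝ => r p.1 p.2 :=
    (hM.sub continuous_const).matrix_mulVec (hgc.comp continuous_snd)
  have hrc' : ∀ c, Continuous (r c) := fun c =>
    hrc.comp (by fun_prop : Continuous fun s : ℝ => (c, s))
  set ρ : ℝ → ℝ := fun c => ∫ s in (0 : ℝ)..τ, ‖r c s‖ with hρ
  have hρ0 : ∀ c, 0 ≤ ρ c := fun c =>
    intervalIntegral.integral_nonneg hτ fun s _ => norm_nonneg _
  have hρlim : Tendsto ρ l (𝓝 0) := by
    have : (0 : ℝ) = ∫ s in (0 : ℝ)..τ, (0 : ℝ) := by simp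
    rw [this]
    have hmem : ∀ {s}, s ∈ Set.uIoc 0 τ → s ∈ Set.Icc 0 τ := fun hs => by
      rw [Set.uIoc_of_le hτ] at hs; exact ⟨hs.1.le, hs.2⟩
    refine intervalIntegral.tendsto_integral_filter_of_dominated_convergence
      (fun s => (K + ‖D‖) * ‖g s‖) (Eventually.of_forall fun c => (hrc' c).norm.aestronglyMeasurable)
      (Eventually.of_forall fun c => Eventually.of_forall fun s hs => ?_)
      ((hgc.norm.const_mul (K + ‖D‖)).intervalIntegrable _ _)
      (Eventually.of_forall fun s hs => ?_)
    · rw [norm_norm]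
      refine (Matrix.linfty_opNorm_mulVec _ _).trans ?_
      gcongr
      exact (norm_sub_le _ _).trans (add_le_add (hMK c s (hmem hs)) le_rfl)
    · have h1 := (hD s (hmem hs)).sub_const D
      rw [sub_self] at h1
      have h2 := h1.norm.mul_const ‖g s‖
      rw [norm_zero, zero_mul] at h2
      exact squeeze_zero (fun c => norm_nonneg _) (fun c => Matrix.linfty_opNorm_mulVec _ _) h2
  have key : ∀ c, ‖f c • a c τ - g τ‖ ≤
      (‖f c • a c 0 - e‖ + K * ρ c) * Real.exp (K * τ) + ρ c := by
    intro c
    -- The coefficients converge only pointwise in s, so the source r is small in L¹ but not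
    -- uniformly. Subtracting its primitive R replaces it by M R, which is bounded uniformly by K ρ
    -- and is therefore accessible to Grönwall.
    set R : ℝ → Fin 2 → ℂ := fun s => ∫ s' in (0 : ℝ)..s, r c s' with hR
    have hRd : ∀ s, HasDerivAt R (r c s) s := fun s =>
      intervalIntegral.integral_hasDerivAt_right ((hrc' c).intervalIntegrable _ _)
        ((hrc' c).stronglyMeasurableAtFilter _ _) (hrc' c).continuousAt
    have hRb : ∀ s ∈ Set.Icc 0 τ, ‖R s‖ ≤ ρ c := fun s hs => by
      refine (intervalIntegral.norm_integral_le_integral_norm hs.1).trans ?_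
      exact intervalIntegral.integral_mono_interval le_rfl hs.1 hs.2
        (Eventually.of_forall fun s => norm_nonneg _) ((hrc' c).norm.intervalIntegrable _ _)
    set b : ℝ → Fin 2 → ℂ := fun s => f c • a c s - g s - R s with hb
    have hbd : ∀ s ∈ Set.Icc 0 τ,
        HasDerivAt b ((M c s).mulVec (b s) + (M c s).mulVec (R s)) s := fun s hs => by
      refine ((((ha c s hs).const_smul (f c)).fun_sub (hgd s)).fun_sub (hRd s)).congr_deriv ?_
      simp only [hb, hr, Matrix.mulVec_sub, Matrix.sub_mulVec, Matrix.mulVec_smul]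
      abel
    have hbb : ∀ s ∈ Set.Icc 0 τ, ‖(M c s).mulVec (b s) + (M c s).mulVec (R s)‖ ≤
        K * ‖b s‖ + K * ρ c := fun s hs => by
      refine (norm_add_le _ _).trans (add_le_add ?_ ?_)
      · exact (Matrix.linfty_opNorm_mulVec _ _).trans
          (mul_le_mul_of_nonneg_right (hMK c s hs) (norm_nonneg _))
      · exact (Matrix.linfty_opNorm_mulVec _ _).trans
          (mul_le_mul (hMK c s hs) (hRb s hs) (norm_nonneg _) (by linarith))
    have hτm : τ ∈ Set.Icc 0 τ := ⟨hτ, le_rfl⟩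
    have h1 := norm_le_mul_exp_of_deriv_le hK (mul_nonneg (by linarith) (hρ0 c)) hbd hbb hτm
    have h2 : b 0 = f c • a c 0 - e := by simp [hb, hg, hR]
    have h3 : f c • a c τ - g τ = b τ + R τ := by simp [hb]
    rw [h2] at h1
    rw [h3]
    exact (norm_add_le _ _).trans (add_le_add h1 (hRb τ hτm))
  rw [tendsto_iff_norm_sub_tendsto_zero] at h0 ⊢
  refine squeeze_zero (fun c => norm_nonneg _) key ?_
  have := ((h0.add (hρlim.const_mul K)).mul_const (Real.exp (K * τ))).add hρlim
  simpa using this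

/-! ### Evolution of solutions of the scattering problem -/

/-- `u` is continuously differentiable with derivatives `ux`, `ut`, and for `t ≥ 0` it satisfies
the sine-Gordon equation in the form `(∂ₜ - ∂ₓ) (u_x + u_t) = - ε⁻² sin u` along the
characteristics `x + t = c`. -/
structure IsCharacteristicSol (ε : ℝ) (u ux ut : ℝ → ℝ → ℝ) : Prop where
  cont_u : Continuous fun q : ℝ × ℝ => u q.1 q.2
  cont_ux : Continuous fun q : ℝ × ℝ => ux q.1 q.2
  cont_ut : Continuous fun q : ℝ × ℝ => ut q.1 q.2
  deriv_x : ∀ x t, HasDerivAt (fun y => u y t) (ux x t) x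
  deriv_t : ∀ x t, HasDerivAt (fun s => u x s) (ut x t) t
  deriv_char : ∀ c s, HasDerivAt (fun s => u (c - s) s) (ut (c - s) s - ux (c - s) s) s
  deriv_sum : ∀ c s, 0 ≤ s → HasDerivAt (fun s => ux (c - s) s + ut (c - s) s)
    (-Real.sin (u (c - s) s) / ε ^ 2) s

/-- The exponent `-i E(z) / ε` of the scattering problem. -/
noncomputable def specExp (ε : ℝ) (z : ℂ) : ℂ := -(Complex.I * specE z / ε)

/-- The normalized potential matrix `Q / (4 i ε)`. -/
noncomputable def potMatrix (ε : ℝ) (P : Potential) (z : ℂ) (x : ℝ) : Matrix (Fin 2) (Fin 2) ℂ :=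
  (4 * Complex.I * ε)⁻¹ • matQ ε P z x

/-- The coefficient matrix of the system satisfied along the characteristics `x + t = const`, at
a point where `u = θ`. -/
noncomputable def charMatrix (ε : ℝ) (z : ℂ) (θ : ℝ) : Matrix (Fin 2) (Fin 2) ℂ :=
  ((2 * Complex.I * ε)⁻¹ * z⁻¹) • !![(Real.cos θ : ℂ), Real.sin θ; Real.sin θ, -Real.cos θ]

/-- The derivative of `charMatrix` with respect to the angle. -/
noncomputable def charMatrix' (ε : ℝ) (z : ℂ) (θ : ℝ) : Matrix (Fin 2) (Fin 2) ℂ :=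
  ((2 * Complex.I * ε)⁻¹ * z⁻¹) • !![-(Real.sin θ : ℂ), Real.cos θ; Real.cos θ, Real.sin θ]

lemma continuous_charMatrix (ε : ℝ) (z : ℂ) : Continuous (charMatrix ε z) := by
  unfold charMatrix
  refine Continuous.fun_const_smul (continuous_matrix fun i k => ?_) _
  fin_cases i <;> fin_cases k <;> simp <;> fun_prop

lemma continuous_charMatrix' (ε : ℝ) (z : ℂ) : Continuous (charMatrix' ε z) := by
  unfold charMatrix'
  refine Continuous.fun_const_smul (continuous_matrix fun i k => ?_) _
  fin_cases i <;> fin_cases k <;> simp <;> fun_prop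

lemma charMatrix_eq (ε : ℝ) (z : ℂ) (θ : ℝ) : charMatrix ε z θ =
    Real.cos θ • ((2 * Complex.I * ε)⁻¹ * z⁻¹) • !![1, 0; 0, -1]
      + Real.sin θ • ((2 * Complex.I * ε)⁻¹ * z⁻¹) • !![0, 1; 1, 0] := by
  ext i k
  fin_cases i <;> fin_cases k <;> simp [charMatrix] <;> ring

lemma hasDerivAt_charMatrix (ε : ℝ) (z : ℂ) (θ : ℝ) :
    HasDerivAt (charMatrix ε z) (charMatrix' ε z θ) θ := by
  rw [funext (charMatrix_eq ε z)]
  refine (((Real.hasDerivAt_cos θ).smul_const _).fun_add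
    ((Real.hasDerivAt_sin θ).smul_const _)).congr_deriv ?_
  ext i k
  fin_cases i <;> fin_cases k <;> simp [charMatrix'] <;> ring

lemma charMatrix_trace (ε : ℝ) (z : ℂ) (θ : ℝ) :
    charMatrix ε z θ 0 0 + charMatrix ε z θ 1 1 = 0 := by
  simp [charMatrix]

lemma potMatrix_trace (ε : ℝ) (P : Potential) (z : ℂ) (x : ℝ) :
    potMatrix ε P z x 0 0 + potMatrix ε P z x 1 1 = 0 := by
  simp [potMatrix, matQ]

/-- Boundedness of the coefficients along characteristics. -/
lemma exists_norm_charMatrix_le (ε : ℝ) (z : ℂ) : ∃ K, 1 ≤ K ∧ ∀ θ, ‖charMatrix ε z θ‖ ≤ K := by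
  obtain ⟨K, hK⟩ := (isCompact_Icc (a := (0 : ℝ)) (b := 2 * Real.pi)).exists_bound_of_continuousOn
    (continuous_charMatrix ε z).continuousOn
  refine ⟨max 1 K, le_max_left _ _, fun θ => ?_⟩
  obtain ⟨θ', h1, h2⟩ := Function.Periodic.exists_mem_Ico₀ (f := charMatrix ε z)
    (fun θ => by simp only [charMatrix, Real.cos_add_two_pi, Real.sin_add_two_pi])
    Real.two_pi_pos θ
  rw [h2]
  exact (hK θ' ⟨h1.1, h1.2.le⟩).trans (le_max_right _ _)

/-- The zero curvature identity: if `a` satisfies the system along a characteristic, then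
`(lam σ₃ + A) a` satisfies the linearized system. -/
lemma IsCharacteristicSol.hasDerivAt_linCoeff_mulVec {ε : ℝ} (hε : ε ≠ 0) {u ux ut : ℝ → ℝ → ℝ}
    (hu : IsCharacteristicSol ε u ux ut) {z : ℂ} (hz : z ≠ 0) {c s : ℝ} (hs : 0 ≤ s)
    {a : ℝ → Fin 2 → ℂ} (ha : HasDerivAt a ((charMatrix ε z (u (c - s) s)).mulVec (a s)) s) :
    HasDerivAt (fun s => (linCoeff (specExp ε z)
        (potMatrix ε (potentialAt ε u ux ut s) z) (c - s)).mulVec (a s))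
      (((ux (c - s) s) • charMatrix' ε z (u (c - s) s)).mulVec (a s) +
        (charMatrix ε z (u (c - s) s)).mulVec ((linCoeff (specExp ε z)
        (potMatrix ε (potentialAt ε u ux ut s) z) (c - s)).mulVec (a s))) s := by
  have hεc : (ε : ℂ) ≠ 0 := Complex.ofReal_ne_zero.2 hε
  have hI := Complex.I_ne_zero
  obtain ⟨a0, a1⟩ := Fin.forall_fin_two.1 (hasDerivAt_pi.1 ha)
  have hC := (hu.deriv_char c s).cos.ofReal_comp
  have hS := (hu.deriv_char c s).sin.ofReal_comp
  have hP := ((((hu.deriv_sum c s hs).const_mul ε).congr_deriv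
    (by field_simp : _ = -(Real.sin (u (c - s) s) * ε⁻¹)))).ofReal_comp
  have hk : 4 * Complex.I * ε * (4 * Complex.I * ε)⁻¹ = 1 :=
    mul_inv_cancel₀ (by simp [hεc])
  have hk4 : 4 * (4 * Complex.I * ε)⁻¹ = -Complex.I * (ε : ℂ)⁻¹ := by
    field_simp
    linear_combination Complex.I_sq
  have hzw : z * z⁻¹ = 1 := mul_inv_cancel₀ hz
  have hE : 4 * specE z = z - z⁻¹ := by unfold specE; ring
  have hk2 : (2 * Complex.I * ε)⁻¹ = 2 * (4 * Complex.I * ε)⁻¹ := by field_simp; norm_num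
  have hM0 : ∀ v, (charMatrix ε z (u (c - s) s)).mulVec v 0 = 2 * (4 * Complex.I * ε)⁻¹ * z⁻¹ *
      ((Real.cos (u (c - s) s) : ℝ) * v 0 + (Real.sin (u (c - s) s) : ℝ) * v 1) := fun v => by
    rw [charMatrix, hk2, Matrix.smul_mulVec]
    simp [dotProduct, Fin.sum_univ_two]
  have hM1 : ∀ v, (charMatrix ε z (u (c - s) s)).mulVec v 1 = 2 * (4 * Complex.I * ε)⁻¹ * z⁻¹ *
      ((Real.sin (u (c - s) s) : ℝ) * v 0 - (Real.cos (u (c - s) s) : ℝ) * v 1) := fun v => by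
    rw [charMatrix, hk2, Matrix.smul_mulVec]
    simp [dotProduct, Fin.sum_univ_two, sub_eq_add_neg]
  have hN0 : ∀ v, (ux (c - s) s • charMatrix' ε z (u (c - s) s)).mulVec v 0 =
      2 * (4 * Complex.I * ε)⁻¹ * z⁻¹ * ux (c - s) s *
      (-(Real.sin (u (c - s) s) : ℝ) * v 0 + (Real.cos (u (c - s) s) : ℝ) * v 1) := fun v => by
    rw [charMatrix', hk2, Matrix.smul_mulVec, Matrix.smul_mulVec]
    simp [dotProduct, Fin.sum_univ_two]
    ring
  have hN1 : ∀ v, (ux (c - s) s • charMatrix' ε z (u (c - s) s)).mulVec v 1 =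
      2 * (4 * Complex.I * ε)⁻¹ * z⁻¹ * ux (c - s) s *
      ((Real.cos (u (c - s) s) : ℝ) * v 0 + (Real.sin (u (c - s) s) : ℝ) * v 1) := fun v => by
    rw [charMatrix', hk2, Matrix.smul_mulVec, Matrix.smul_mulVec]
    simp [dotProduct, Fin.sum_univ_two]
    ring
  have hL0 : ∀ s, (linCoeff (specExp ε z) (potMatrix ε (potentialAt ε u ux ut s) z)
      (c - s)).mulVec (a s) 0 = (4 * Complex.I * ε)⁻¹ * ((4 * specE z + z⁻¹ * (1 -
        (Real.cos (u (c - s) s) : ℝ))) * a s 0 + (-z⁻¹ * (Real.sin (u (c - s) s) : ℝ) - Complex.I *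
        ((ε * (ux (c - s) s + ut (c - s) s) : ℝ) : ℂ)) * a s 1) := fun s => by
    simp only [linCoeff, specExp, potMatrix, matQ, potentialAt, Matrix.mulVec, dotProduct,
      Fin.sum_univ_two, Matrix.add_apply, Matrix.smul_apply, smul_eq_mul]
    simp
    field_simp
    ring
  have hL1 : ∀ s, (linCoeff (specExp ε z) (potMatrix ε (potentialAt ε u ux ut s) z)
      (c - s)).mulVec (a s) 1 = (4 * Complex.I * ε)⁻¹ * ((-z⁻¹ * (Real.sin (u (c - s) s) : ℝ) +
        Complex.I * ((ε * (ux (c - s) s + ut (c - s) s) : ℝ) : ℂ)) * a s 0 - (4 * specE z + z⁻¹ *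
        (1 - (Real.cos (u (c - s) s) : ℝ))) * a s 1) := fun s => by
    simp only [linCoeff, specExp, potMatrix, matQ, potentialAt, Matrix.mulVec, dotProduct,
      Fin.sum_univ_two, Matrix.add_apply, Matrix.smul_apply, smul_eq_mul]
    simp
    field_simp
    ring
  rw [hasDerivAt_pi, Fin.forall_fin_two]
  constructor
  · simp only [hL0]
    have hd := ((((((hC.const_sub 1).const_mul z⁻¹).const_add (4 * specE z)).fun_mul a0).fun_add
      (((hS.const_mul (-z⁻¹)).fun_sub (hP.const_mul Complex.I)).fun_mul a1)).const_mul
        (4 * Complex.I * ε)⁻¹)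
    refine hd.congr_deriv ?_
    rw [Pi.add_apply, hN0, hM0, hM0, hM1, hL0, hL1, hE]
    push_cast
    generalize (4 * Complex.I * (ε : ℂ))⁻¹ = k at *
    -- The terms with u_x + u_t cancel through k · 4 i ε = 1. By 4 k = -i / ε the sine-Gordon source
    -- i k sin u / ε becomes -4 k² sin u, which cancels the z z⁻¹ part of the commutator of 4 E σ₃
    -- with `charMatrix`.
    linear_combination (k * z⁻¹ * (ux (c - s) s + ut (c - s) s)) *
      (Complex.cos (u (c - s) s) * a s 1 - Complex.sin (u (c - s) s) * a s 0) * hk +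
      4 * k ^ 2 * a s 1 * Complex.sin (u (c - s) s) * hzw +
      k * a s 1 * Complex.sin (u (c - s) s) * hk4
  · simp only [hL1]
    have hd := (((((hS.const_mul (-z⁻¹)).fun_add (hP.const_mul Complex.I)).fun_mul a0).fun_sub
      ((((hC.const_sub 1).const_mul z⁻¹).const_add (4 * specE z)).fun_mul a1)).const_mul
        (4 * Complex.I * ε)⁻¹)
    refine hd.congr_deriv ?_
    rw [Pi.add_apply, hN1, hM0, hM1, hM1, hL0, hL1, hE]
    push_cast
    generalize (4 * Complex.I * (ε : ℂ))⁻¹ = k at *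
    linear_combination (k * z⁻¹ * (ux (c - s) s + ut (c - s) s)) *
      (Complex.cos (u (c - s) s) * a s 0 + Complex.sin (u (c - s) s) * a s 1) * hk -
      4 * k ^ 2 * a s 0 * Complex.sin (u (c - s) s) * hzw -
      k * a s 0 * Complex.sin (u (c - s) s) * hk4

/-- Solutions of the system along the characteristics solve the scattering problem at time `τ` if
and only if they do so at time `0`. -/
theorem IsCharacteristicSol.isLinSol_iff {ε : ℝ} (hε : ε ≠ 0) {u ux ut : ℝ → ℝ → ℝ}
    (hu : IsCharacteristicSol ε u ux ut) {z : ℂ} (hz : z ≠ 0) {τ : ℝ} (hτ : 0 ≤ τ)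
    {a : ℝ → ℝ → Fin 2 → ℂ} (ha : ∀ c, ∀ s ∈ Set.Icc 0 τ,
      HasDerivAt (a c) ((charMatrix ε z (u (c - s) s)).mulVec (a c s)) s) :
    IsLinSol (linCoeff (specExp ε z) (potMatrix ε (potentialAt ε u ux ut τ) z))
      (fun x => a (x + τ) τ) ↔
    IsLinSol (linCoeff (specExp ε z) (potMatrix ε (potentialAt ε u ux ut 0) z))
      (fun x => a x 0) := by
  have hφ : Continuous fun p : ℝ × ℝ => (p.1 - p.2, p.2) := by fun_prop
  have hM : Continuous fun p : ℝ × ℝ => charMatrix ε z (u (p.1 - p.2) p.2) :=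
    (continuous_charMatrix ε z).comp (hu.cont_u.comp hφ)
  have hN : Continuous fun p : ℝ × ℝ =>
      ux (p.1 - p.2) p.2 • charMatrix' ε z (u (p.1 - p.2) p.2) :=
    (hu.cont_ux.comp hφ).smul ((continuous_charMatrix' ε z).comp (hu.cont_u.comp hφ))
  have hMN : ∀ c s, HasDerivAt (fun c => charMatrix ε z (u (c - s) s))
      (ux (c - s) s • charMatrix' ε z (u (c - s) s)) c := fun c s => by
    have h1 := (hu.deriv_x (c - s) s).comp_sub_const c s
    exact (hasDerivAt_charMatrix ε z _).scomp c h1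
  -- At fixed s, differentiating in c is differentiating in x = c - s, so the scattering problem at
  -- time s says exactly that ∂_c a = q. Both sides solve the same linearized equation, and
  -- agreement propagates from either end.
  set q : ℝ → ℝ → Fin 2 → ℂ := fun c s => (linCoeff (specExp ε z)
    (potMatrix ε (potentialAt ε u ux ut s) z) (c - s)).mulVec (a c s) with hq
  have hqd : ∀ c, ∀ s ∈ Set.Icc 0 τ, HasDerivAt (q c)
      ((ux (c - s) s • charMatrix' ε z (u (c - s) s)).mulVec (a c s) +
        (charMatrix ε z (u (c - s) s)).mulVec (q c s)) s := fun c s hs =>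
    hu.hasDerivAt_linCoeff_mulVec hε hz hs.1 (ha c s hs)
  constructor
  · intro h c
    have h0 : HasDerivAt (fun c => a c τ) (q c τ) c := by
      have := (h (c - τ)).comp_sub_const c τ
      simpa [hq] using this
    have := hasDerivAt_param_right hM hN hMN ha (hqd c) h0 ⟨le_rfl, hτ⟩
    simpa [hq] using this
  · intro h x
    have h0 : HasDerivAt (fun c => a c 0) (q (x + τ) 0) (x + τ) := by
      have := h (x + τ)
      simpa [hq] using this
    have := (hasDerivAt_param hM hN hMN ha (hqd (x + τ)) h0 ⟨hτ, le_rfl⟩).comp_add_const x τ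
    simpa [hq] using this

/-! ### Weak derivatives on the line -/

/-- Integration by parts for absolutely continuous functions on an interval (-R, R) containing the
support of φ; the boundary terms vanish, and Lebesgue differentiation identifies the derivative of
the primitive with g. -/
lemma integral_primitive_mul_deriv {g φ : ℝ → ℝ} (hg : LocallyIntegrable g)
    (hφ : ContDiff ℝ ∞ φ) (hs : HasCompactSupport φ) :
    ∫ x, (∫ y in (0 : ℝ)..x, g y) * deriv φ x = -∫ x, g x * φ x := by
  obtain ⟨R, hR0, hR⟩ := hs.isBounded.exists_pos_norm_lt
  have hφ0 : ∀ x, x ∉ Set.Ioo (-R) R → φ x = 0 := fun x hx => by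
    by_contra h
    have := hR x (subset_tsupport _ h)
    rw [Real.norm_eq_abs, abs_lt] at this
    exact hx this
  have hdφ0 : ∀ x, x ∉ Set.Ioo (-R) R → deriv φ x = 0 := fun x hx => by
    by_contra h
    have := hR x (support_deriv_subset h)
    rw [Real.norm_eq_abs, abs_lt] at this
    exact hx this
  have hii : IntervalIntegrable g volume (-R) R := intervalIntegrable_iff.2 ((hg.integrableOn_isCompact isCompact_uIcc).mono_set
    Set.uIoc_subset_uIcc)
  have hint : ∀ {f : ℝ → ℝ}, (∀ x, x ∉ Set.Ioo (-R) R → f x = 0) →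
      ∫ x, f x = ∫ x in (-R)..R, f x := fun {f} hf => by
    rw [intervalIntegral.integral_of_le (by linarith), setIntegral_eq_integral_of_forall_compl_eq_zero]
    intro x hx
    exact hf x fun h => hx ⟨h.1, h.2.le⟩
  rw [hint fun x hx => by rw [hdφ0 x hx, mul_zero], hint fun x hx => by rw [hφ0 x hx, mul_zero]]
  have hAC : AbsolutelyContinuousOnInterval (fun x => ∫ y in (0 : ℝ)..x, g y) (-R) R :=
    hii.absolutelyContinuousOnInterval_intervalIntegral (by
      rw [Set.uIcc_of_le (by linarith)]; constructor <;> linarith)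
  have hφAC : AbsolutelyContinuousOnInterval φ (-R) R :=
    (hφ.of_le (by exact_mod_cast le_top)).contDiffOn.absolutelyContinuousOnInterval
  rw [hAC.integral_mul_deriv_eq_deriv_mul hφAC, hφ0 R (by simp), hφ0 (-R) (by simp)]
  simp only [mul_zero, sub_zero, zero_sub, neg_inj]
  refine intervalIntegral.integral_congr_ae ?_
  filter_upwards [LocallyIntegrable.ae_hasDerivAt_integral hg] with x hx _
  rw [(hx 0).deriv]

/-- A function with vanishing weak derivative is constant. -/
lemma ae_eq_const_of_integral_mul_deriv_eq_zero {h : ℝ → ℝ} (hh : LocallyIntegrable h)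
    (h0 : ∀ φ : ℝ → ℝ, ContDiff ℝ ∞ φ → HasCompactSupport φ → ∫ x, h x * deriv φ x = 0) :
    ∃ C, ∀ᵐ x, h x = C := by
  have hprod : ∀ {φ : ℝ → ℝ}, ContDiff ℝ ∞ φ → HasCompactSupport φ →
      Integrable fun x => h x * φ x := fun {φ} hφ hs =>
    hh.integrable_smul_right_of_hasCompactSupport hφ.continuous hs
  set b : ContDiffBump (0 : ℝ) := ⟨1, 2, by norm_num, by norm_num⟩
  set ψ : ℝ → ℝ := b.normed volume with hψd
  have hψ : ContDiff ℝ ∞ ψ := b.contDiff_normed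
  have hψs : HasCompactSupport ψ := b.hasCompactSupport_normed
  refine ⟨∫ x, h x * ψ x, ?_⟩
  refine ae_eq_of_integral_contDiff_smul_eq hh (locallyIntegrable_const _) fun φ hφ hs => ?_
  set m := ∫ x, φ x with hm
  -- Subtracting a multiple of a bump of integral 1 gives a test function of mean zero. Its
  -- primitive then has compact support and is admissible in the hypothesis.
  set χ : ℝ → ℝ := fun x => φ x - m * ψ x with hχ
  have hχd : ContDiff ℝ ∞ χ := hφ.sub (contDiff_const.mul hψ)
  have hχs : HasCompactSupport χ := hs.sub hψs.mul_left
  have hχ0 : ∫ x, χ x = 0 := by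
    rw [integral_sub (hφ.continuous.integrable_of_hasCompactSupport hs)
      ((hψ.continuous.integrable_of_hasCompactSupport hψs).const_mul m), integral_const_mul,
      hψd, b.integral_normed, mul_one, sub_self]
  obtain ⟨R, hR0, hR⟩ := hχs.isBounded.exists_pos_norm_lt
  have hχz : ∀ x, x ∉ Set.Ioo (-R) R → χ x = 0 := fun x hx => by
    by_contra h
    have := hR x (subset_tsupport _ h)
    rw [Real.norm_eq_abs, abs_lt] at this
    exact hx this
  set Φ : ℝ → ℝ := fun x => ∫ y in (-R)..x, χ y with hΦ
  have hΦd : ∀ x, HasDerivAt Φ (χ x) x := fun x =>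
    intervalIntegral.integral_hasDerivAt_right (hχd.continuous.intervalIntegrable _ _)
      (hχd.continuous.stronglyMeasurableAtFilter _ _) hχd.continuous.continuousAt
  have hΦderiv : deriv Φ = χ := funext fun x => (hΦd x).deriv
  have hΦc : ContDiff ℝ ∞ Φ :=
    contDiff_infty_iff_deriv.2 ⟨fun x => (hΦd x).differentiableAt, by rwa [hΦderiv]⟩
  have hΦs : HasCompactSupport Φ := by
    refine HasCompactSupport.intro (isCompact_Icc (a := -R) (b := R)) fun x hx => ?_
    rcases lt_or_ge x (-R) with h | h
    · have : ∀ y ∈ Set.uIcc (-R) x, χ y = 0 := fun y hy => by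
        rw [Set.uIcc_of_ge h.le] at hy
        exact hχz y fun h' => by linarith [h'.1, hy.2]
      rw [hΦ]
      simp only
      rw [intervalIntegral.integral_congr this]; simp
    · have hx : R ≤ x := by
        by_contra! h'
        exact hx ⟨h, h'.le⟩
      rw [← hχ0, hΦ]
      simp only
      rw [intervalIntegral.integral_of_le (by linarith),
        setIntegral_eq_integral_of_forall_compl_eq_zero]
      intro y hy
      refine hχz y fun h' => hy ⟨h'.1, by linarith [h'.2]⟩
  have h1 := h0 Φ hΦc hΦs
  rw [hΦderiv] at h1
  have h2 : ∀ x, h x * χ x = h x * φ x - m * (h x * ψ x) := fun x => by rw [hχ]; ring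
  simp only [h2] at h1
  rw [integral_sub (hprod hφ hs) ((hprod hψ hψs).const_mul m), integral_const_mul, sub_eq_zero] at h1
  simp only [smul_eq_mul]
  rw [integral_mul_const, ← hm, ← h1]
  simp only [mul_comm]

/-- A function with a weak derivative is, up to a constant, its primitive. -/
lemma HasWeakDeriv.exists_ae_eq {f g : ℝ → ℝ} (h : HasWeakDeriv f g) :
    ∃ C, ∀ᵐ x, f x = C + ∫ y in (0 : ℝ)..x, g y := by
  have hc : Continuous fun x => ∫ y in (0 : ℝ)..x, g y :=
    intervalIntegral.continuous_primitive (fun a b => intervalIntegrable_iff.2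
      ((h.2.1.integrableOn_isCompact isCompact_uIcc).mono_set Set.uIoc_subset_uIcc)) 0
  obtain ⟨C, hC⟩ := ae_eq_const_of_integral_mul_deriv_eq_zero
    (h := fun x => f x - ∫ y in (0 : ℝ)..x, g y) (h.1.sub hc.locallyIntegrable) fun φ hφ hs => by
      have hφ' : Continuous (deriv φ) := hφ.continuous_deriv (by exact_mod_cast le_top)
      simp only [sub_mul]
      rw [integral_sub, h.2.2 φ hφ hs, integral_primitive_mul_deriv h.2.1 hφ hs, sub_self]
      · exact h.1.integrable_smul_right_of_hasCompactSupport hφ' hs.deriv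
      · exact hc.locallyIntegrable.integrable_smul_right_of_hasCompactSupport hφ' hs.deriv
  refine ⟨C, hC.mono fun x hx => ?_⟩
  rw [← hx]; ring

/-- A weak derivative is unique: it agrees with the classical derivative. -/
lemma HasWeakDeriv.ae_eq_of_hasDerivAt {f g g' : ℝ → ℝ} (h : HasWeakDeriv f g)
    (hd : ∀ x, HasDerivAt f (g' x) x) (hg' : Continuous g') : ∀ᵐ x, g x = g' x := by
  have hf : Continuous f := continuous_iff_continuousAt.2 fun x => (hd x).continuousAt
  refine ae_eq_of_integral_contDiff_smul_eq h.2.1 hg'.locallyIntegrable fun φ hφ hs => ?_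
  have hφ' : Continuous (deriv φ) := hφ.continuous_deriv (by exact_mod_cast le_top)
  have h1 := h.2.2 φ hφ hs
  rw [integral_mul_deriv_eq_deriv_mul_of_integrable (u' := g') (fun x _ => hd x)
    (fun x _ => (hφ.differentiable (by simp) x).hasDerivAt)
    ((hf.mul hφ').integrable_of_hasCompactSupport hs.deriv.mul_left)
    ((hg'.mul hφ.continuous).integrable_of_hasCompactSupport hs.mul_left)
    ((hf.mul hφ.continuous).integrable_of_hasCompactSupport hs.mul_left), neg_inj] at h1
  simp only [smul_eq_mul, mul_comm (φ _)]
  exact h1.symm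

/-! ### Integrals with a parameter -/

/-- The derivative of `y ↦ ∫₀^(t y) g (c y, s) ds` along a curve. -/
lemma hasDerivAt_intervalIntegral_curve {g g' : ℝ → ℝ → ℝ}
    (hg : Continuous fun p : ℝ × ℝ => g p.1 p.2) (hg' : Continuous fun p : ℝ × ℝ => g' p.1 p.2)
    (hd : ∀ c s, HasDerivAt (fun c => g c s) (g' c s) c) {c t : ℝ → ℝ} {c' t' y : ℝ}
    (hc : HasDerivAt c c' y) (ht : HasDerivAt t t' y) :
    HasDerivAt (fun y => ∫ s in (0 : ℝ)..t y, g (c y) s)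
      ((∫ s in (0 : ℝ)..t y, g' (c y) s) * c' + g (c y) (t y) * t') y := by
  have hgc : ∀ c, Continuous (g c) := fun c => hg.comp (by fun_prop : Continuous fun s : ℝ => (c, s))
  have hgc' : ∀ c, Continuous (g' c) := fun c =>
    hg'.comp (by fun_prop : Continuous fun s : ℝ => (c, s))
  have h1 : ∀ a b, HasDerivAt (fun a => ∫ s in (0 : ℝ)..b, g a s) (∫ s in (0 : ℝ)..b, g' a s) a := by
    intro a b
    obtain ⟨K, hK⟩ := ((isCompact_closedBall a 1).prod
      (isCompact_uIcc (a := (0 : ℝ)) (b := b))).exists_bound_of_continuousOn hg'.continuousOn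
    exact (intervalIntegral.hasDerivAt_integral_of_dominated_loc_of_deriv_le
      (Metric.closedBall_mem_nhds a one_pos)
      (Eventually.of_forall fun x => (hgc x).aestronglyMeasurable)
      ((hgc a).intervalIntegrable _ _) (hgc' a).aestronglyMeasurable
      (bound := fun _ => K)
      (Eventually.of_forall fun s hs x hx => hK (x, s) ⟨hx, Set.uIoc_subset_uIcc hs⟩)
      (continuous_const.intervalIntegrable _ _)
      (Eventually.of_forall fun s _ x _ => hd x s)).2
  have h2 : ∀ a b, HasDerivAt (fun b => ∫ s in (0 : ℝ)..b, g a s) (g a b) b := fun a b =>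
    intervalIntegral.integral_hasDerivAt_right ((hgc a).intervalIntegrable _ _)
      ((hgc a).stronglyMeasurableAtFilter _ _) (hgc a).continuousAt
  have hcont1 : Continuous fun p : ℝ × ℝ => ∫ s in (0 : ℝ)..p.2, g' p.1 s :=
    intervalIntegral.continuous_parametric_intervalIntegral_of_continuous
      (f := fun (p : ℝ × ℝ) s => g' p.1 s)
      (hg'.comp (by fun_prop : Continuous fun q : (ℝ × ℝ) × ℝ => (q.1.1, q.2))) continuous_snd
  -- The partial derivatives in the parameter and in the endpoint are jointly continuous, so the
  -- integral is totally differentiable and the chain rule applies along the curve.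
  have hF := hasStrictFDerivAt_uncurry_coprod (𝕜 := ℝ) (u := (c y, t y))
    (f := fun a b => ∫ s in (0 : ℝ)..b, g a s)
    (f₁ := fun a b => ContinuousLinearMap.toSpanSingleton ℝ (∫ s in (0 : ℝ)..b, g' a s))
    (f₂ := fun a b => ContinuousLinearMap.toSpanSingleton ℝ (g a b))
    (Eventually.of_forall fun v => (h1 v.1 v.2).hasFDerivAt)
    (Eventually.of_forall fun v => (h2 v.1 v.2).hasFDerivAt)
    ((ContinuousLinearMap.toSpanSingletonCLE (𝕜 := ℝ) (E := ℝ)).continuous.comp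
      hcont1).continuousAt
    ((ContinuousLinearMap.toSpanSingletonCLE (𝕜 := ℝ) (E := ℝ)).continuous.comp hg).continuousAt
  have := hF.hasFDerivAt.comp_hasDerivAt y (hc.prodMk ht)
  simp [Function.HasUncurry.uncurry, Function.comp_def] at this
  refine this.congr_deriv ?_
  ring

/-! ### Regularity of weak solutions -/

/-- A continuous function whose weak derivative is almost everywhere equal to a continuous function
is continuously differentiable. -/
lemma HasWeakDeriv.hasDerivAt {f g α : ℝ → ℝ} (h : HasWeakDeriv f g) (hf : Continuous f)
    (hα : Continuous α) (hg : ∀ᵐ x, g x = α x) (x : ℝ) : HasDerivAt f (α x) x := by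
  obtain ⟨C, hC⟩ := h.exists_ae_eq
  have h1 : f = fun x => C + ∫ y in (0 : ℝ)..x, α y := by
    refine Continuous.ae_eq_iff_eq volume hf (continuous_const.add
      (intervalIntegral.continuous_primitive (fun a b => hα.intervalIntegrable a b) 0)) |>.1 ?_
    filter_upwards [hC] with x hx
    rw [hx, intervalIntegral.integral_congr_ae (hg.mono fun y hy _ => hy)]
    rfl
  rw [h1]
  exact (intervalIntegral.integral_hasDerivAt_right (hα.intervalIntegrable _ _)
    (hα.stronglyMeasurableAtFilter _ _) hα.continuousAt).const_add C

lemma HasWeakDeriv.exists_continuous_ae_eq {f g : ℝ → ℝ} (h : HasWeakDeriv f g) :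
    ∃ α : ℝ → ℝ, Continuous α ∧ ∀ᵐ x, f x = α x := by
  obtain ⟨C, hC⟩ := h.exists_ae_eq
  exact ⟨_, continuous_const.add (intervalIntegral.continuous_primitive
    (fun a b => intervalIntegrable_iff.2 ((h.2.1.integrableOn_isCompact isCompact_uIcc).mono_set
      Set.uIoc_subset_uIcc)) 0), hC⟩

/-- The right hand side of Duhamel's formula is continuously differentiable. -/
theorem exists_duhamel_deriv {κ : ℝ} {u₀ α β : ℝ → ℝ} {G : ℝ → ℝ → ℝ} (hα : Continuous α)
    (hβ : Continuous β) (hu₀ : ∀ x, HasDerivAt u₀ (α x) x)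
    (hG : Continuous fun p : ℝ × ℝ => G p.1 p.2) :
    ∃ v vx vt : ℝ → ℝ → ℝ, (∀ x t, 0 ≤ t → v x t = (u₀ (x + t) + u₀ (x - t)) / 2 +
        (∫ y in (x - t)..(x + t), β y) / 2 -
        κ / 2 * ∫ s in (0 : ℝ)..t, ∫ y in (x - (t - s))..(x + (t - s)), G y s) ∧
      (Continuous fun p : ℝ × ℝ => v p.1 p.2) ∧ (Continuous fun p : ℝ × ℝ => vx p.1 p.2) ∧ (Continuous fun p : ℝ × ℝ => vt p.1 p.2) ∧
      (∀ (x t : ℝ → ℝ) (x' t' y : ℝ), HasDerivAt x x' y → HasDerivAt t t' y →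
        HasDerivAt (fun y => v (x y) (t y)) (vx (x y) (t y) * x' + vt (x y) (t y) * t') y) ∧
      ∀ x t, vx x t + vt x t = α (x + t) + β (x + t) - κ * ∫ s in (0 : ℝ)..t, G (x + t - s) s := by
  -- A primitive of G in space turns the integral over the backward cone into a difference of two
  -- single integrals, one along each characteristic. In vx + vt only the one along x + t = const
  -- survives.
  set Γ : ℝ → ℝ → ℝ := fun y s => ∫ r in (0 : ℝ)..y, G r s with hΓ
  have hGc : ∀ s, Continuous fun y => G y s := fun s =>
    hG.comp (by fun_prop : Continuous fun y : ℝ => (y, s))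
  have hGi : ∀ s a b, IntervalIntegrable (fun y => G y s) volume a b := fun s a b =>
    (hGc s).intervalIntegrable a b
  have hΓc : Continuous fun p : ℝ × ℝ => Γ p.1 p.2 :=
    intervalIntegral.continuous_parametric_intervalIntegral_of_continuous
      (f := fun (p : ℝ × ℝ) r => G r p.2)
      (hG.comp (by fun_prop : Continuous fun q : (ℝ × ℝ) × ℝ => (q.2, q.1.2))) continuous_fst
  have hΓd : ∀ y s, HasDerivAt (fun y => Γ y s) (G y s) y := fun y s =>
    intervalIntegral.integral_hasDerivAt_right (hGi s _ _)
      ((hGc s).stronglyMeasurableAtFilter _ _) (hGc s).continuousAt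
  set B : ℝ → ℝ := fun x => ∫ y in (0 : ℝ)..x, β y with hB
  have hBd : ∀ x, HasDerivAt B (β x) x := fun x =>
    intervalIntegral.integral_hasDerivAt_right (hβ.intervalIntegrable _ _)
      (hβ.stronglyMeasurableAtFilter _ _) hβ.continuousAt
  set v : ℝ → ℝ → ℝ := fun x t => (u₀ (x + t) + u₀ (x - t)) / 2 + (B (x + t) - B (x - t)) / 2 -
    κ / 2 * ((∫ s in (0 : ℝ)..t, Γ (x + t - s) s) - ∫ s in (0 : ℝ)..t, Γ (x - t + s) s) with hv
  set I₁ : ℝ → ℝ → ℝ := fun x t => ∫ s in (0 : ℝ)..t, G (x + t - s) s with hI₁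
  set I₂ : ℝ → ℝ → ℝ := fun x t => ∫ s in (0 : ℝ)..t, G (x - t + s) s with hI₂
  have hI₁c : Continuous fun p : ℝ × ℝ => I₁ p.1 p.2 :=
    intervalIntegral.continuous_parametric_intervalIntegral_of_continuous
      (f := fun (p : ℝ × ℝ) s => G (p.1 + p.2 - s) s)
      (hG.comp (by fun_prop : Continuous fun q : (ℝ × ℝ) × ℝ => (q.1.1 + q.1.2 - q.2, q.2)))
      continuous_snd
  have hI₂c : Continuous fun p : ℝ × ℝ => I₂ p.1 p.2 :=
    intervalIntegral.continuous_parametric_intervalIntegral_of_continuous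
      (f := fun (p : ℝ × ℝ) s => G (p.1 - p.2 + s) s)
      (hG.comp (by fun_prop : Continuous fun q : (ℝ × ℝ) × ℝ => (q.1.1 - q.1.2 + q.2, q.2)))
      continuous_snd
  have hJ₁c : Continuous fun p : ℝ × ℝ => ∫ s in (0 : ℝ)..p.2, Γ (p.1 + p.2 - s) s :=
    intervalIntegral.continuous_parametric_intervalIntegral_of_continuous
      (f := fun (p : ℝ × ℝ) s => Γ (p.1 + p.2 - s) s)
      (hΓc.comp (by fun_prop : Continuous fun q : (ℝ × ℝ) × ℝ => (q.1.1 + q.1.2 - q.2, q.2)))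
      continuous_snd
  have hJ₂c : Continuous fun p : ℝ × ℝ => ∫ s in (0 : ℝ)..p.2, Γ (p.1 - p.2 + s) s :=
    intervalIntegral.continuous_parametric_intervalIntegral_of_continuous
      (f := fun (p : ℝ × ℝ) s => Γ (p.1 - p.2 + s) s)
      (hΓc.comp (by fun_prop : Continuous fun q : (ℝ × ℝ) × ℝ => (q.1.1 - q.1.2 + q.2, q.2)))
      continuous_snd
  have hu₀c : Continuous u₀ := continuous_iff_continuousAt.2 fun x => (hu₀ x).continuousAt
  have hBc : Continuous B := continuous_iff_continuousAt.2 fun x => (hBd x).continuousAt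
  refine ⟨v, fun x t => (α (x + t) + α (x - t)) / 2 + (β (x + t) - β (x - t)) / 2 -
      κ / 2 * (I₁ x t - I₂ x t),
    fun x t => (α (x + t) - α (x - t)) / 2 + (β (x + t) + β (x - t)) / 2 -
      κ / 2 * (I₁ x t + I₂ x t), fun x t ht => ?_, by fun_prop, by fun_prop, by fun_prop, ?_, fun x t => ?_⟩
  · simp only [hv]
    congr 2
    · rw [hB, intervalIntegral.integral_interval_sub_left (hβ.intervalIntegrable _ _)
        (hβ.intervalIntegrable _ _)]
    · rw [← intervalIntegral.integral_sub]
      · refine intervalIntegral.integral_congr fun s _ => ?_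
        simp only [hΓ]
        rw [intervalIntegral.integral_interval_sub_left (hGi s _ _) (hGi s _ _)]
        congr 1 <;> ring
      · exact (hΓc.comp (by fun_prop : Continuous fun s : ℝ =>
          (x + t - s, s))).intervalIntegrable _ _
      · exact (hΓc.comp (by fun_prop : Continuous fun s : ℝ =>
          (x - t + s, s))).intervalIntegrable _ _
  · intro x t x' t' y hx ht
    have hp := hx.fun_add ht
    have hm := hx.fun_sub ht
    have hK := hasDerivAt_intervalIntegral_curve (g := fun c s => Γ (c - s) s)
      (g' := fun c s => G (c - s) s)
      (hΓc.comp (by fun_prop : Continuous fun q : ℝ × ℝ => (q.1 - q.2, q.2)))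
      (hG.comp (by fun_prop : Continuous fun q : ℝ × ℝ => (q.1 - q.2, q.2)))
      (fun c s => (hΓd (c - s) s).comp_sub_const c s) hp ht
    have hJ := hasDerivAt_intervalIntegral_curve (g := fun c s => Γ (c + s) s)
      (g' := fun c s => G (c + s) s)
      (hΓc.comp (by fun_prop : Continuous fun q : ℝ × ℝ => (q.1 + q.2, q.2)))
      (hG.comp (by fun_prop : Continuous fun q : ℝ × ℝ => (q.1 + q.2, q.2)))
      (fun c s => (hΓd (c + s) s).comp_add_const c s) hm ht
    have h1 := (hu₀ (x y + t y)).comp y hp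
    have h2 := (hu₀ (x y - t y)).comp y hm
    have h3 := (hBd (x y + t y)).comp y hp
    have h4 := (hBd (x y - t y)).comp y hm
    refine ((((h1.fun_add h2).div_const 2).fun_add ((h3.fun_sub h4).div_const 2)).fun_sub
      ((hK.fun_sub hJ).const_mul (κ / 2))).congr_deriv ?_
    simp only [hI₁, hI₂, add_sub_cancel_right, sub_add_cancel]
    ring
  · ring

/-- A weak solution with `L¹`-Sobolev regularity is continuously differentiable, and its
distributional derivatives are represented by the classical ones. -/
theorem exists_isCharacteristicSol {ε : ℝ} {u ux uxx ut utx : ℝ → ℝ → ℝ}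
    (hsol : IsWeakSolution ε u (fun x => ut x 0))
    (hreg : HasL1SobolevRegularity u ux uxx ut utx) :
    ∃ v vx vt : ℝ → ℝ → ℝ, IsCharacteristicSol ε v vx vt ∧ (∀ x t, 0 ≤ t → u x t = v x t) ∧
      ∀ t, 0 ≤ t → (∀ᵐ x, ux x t = vx x t) ∧ ∀ᵐ x, ut x t = vt x t := by
  obtain ⟨α, hα, hαe⟩ := (hreg.weakDeriv_xx 0 le_rfl).exists_continuous_ae_eq
  obtain ⟨β, hβ, hβe⟩ := (hreg.weakDeriv_tx 0 le_rfl).exists_continuous_ae_eq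
  have hu₀c : Continuous fun x => u x 0 :=
    continuousOn_univ.1 (hsol.continuousOn.comp (f := fun x : ℝ => (x, (0 : ℝ))) (by fun_prop)
      fun x _ => ⟨trivial, Set.self_mem_Ici⟩)
  have hu₀ : ∀ x, HasDerivAt (fun x => u x 0) (α x) x :=
    (hreg.weakDeriv_x 0 le_rfl).hasDerivAt hu₀c hα hαe
  -- The source is frozen at its initial value for negative times. This extends Duhamel's formula to
  -- all real t, so that derivatives at t = 0 can be taken two-sided.
  have hG : Continuous fun p : ℝ × ℝ => Real.sin (u p.1 (max p.2 0)) :=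
    Real.continuous_sin.comp (continuousOn_univ.1 (hsol.continuousOn.comp
      (f := fun p : ℝ × ℝ => (p.1, max p.2 0)) (by fun_prop) fun p _ => ⟨trivial, Set.mem_Ici.2 (le_max_right _ _)⟩))
  obtain ⟨v, vx, vt, hv, hvc, hvx, hvt, hcurve, hsum⟩ := exists_duhamel_deriv (κ := 1 / ε ^ 2)
    (G := fun y s => Real.sin (u y (max s 0))) hα hβ hu₀ hG
  have huv : ∀ x t, 0 ≤ t → u x t = v x t := fun x t ht => by
    rw [hv x t ht, hsol.duhamel x t ht]
    congr 1
    · congr 2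
      exact intervalIntegral.integral_congr_ae (hβe.mono fun y hy _ => hy)
    · congr 1
      · ring
      · refine intervalIntegral.integral_congr fun s hs => ?_
        rw [Set.uIcc_of_le ht] at hs
        simp only [max_eq_left hs.1]
  have hdx : ∀ x t, HasDerivAt (fun y => v y t) (vx x t) x := fun x t => by
    simpa using hcurve _ _ _ _ x (hasDerivAt_id x) (hasDerivAt_const x t)
  have hdt : ∀ x t, HasDerivAt (fun s => v x s) (vt x t) t := fun x t => by
    simpa using hcurve _ _ _ _ t (hasDerivAt_const t x) (hasDerivAt_id t)
  refine ⟨v, vx, vt, ⟨hvc, hvx, hvt, hdx, hdt, fun c s => ?_, fun c s hs => ?_⟩, huv,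
    fun t ht => ⟨?_, ?_⟩⟩
  · refine (hcurve _ _ _ _ s ((hasDerivAt_id s).const_sub c) (hasDerivAt_id s)).congr_deriv ?_
    simp only [id]; ring
  · simp only [hsum, sub_add_cancel]
    have hcr : Continuous fun r : ℝ => (c - r, r) := by fun_prop
    have hg : Continuous fun r => Real.sin (u (c - r) (max r 0)) := by
      simpa only [Function.comp_def] using hG.comp hcr
    have := ((intervalIntegral.integral_hasDerivAt_right (hg.intervalIntegrable 0 s)
      (hg.stronglyMeasurableAtFilter _ _) hg.continuousAt).const_mul (1 / ε ^ 2)).const_sub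
        (α c + β c)
    refine this.congr_deriv ?_
    rw [max_eq_left hs, huv _ _ hs]; ring
  · have h1 := hreg.weakDeriv_x t ht
    simp only [huv _ _ ht] at h1
    exact h1.ae_eq_of_hasDerivAt (fun x => hdx x t)
      (hvx.comp (by fun_prop : Continuous fun x : ℝ => (x, t)))
  · have hvtc : ∀ s, Continuous fun x => vt x s := fun s =>
      hvt.comp (by fun_prop : Continuous fun x : ℝ => (x, s))
    have hvc' : ∀ s, Continuous fun x => v x s := fun s =>
      hvc.comp (by fun_prop : Continuous fun x : ℝ => (x, s))
    -- Against any test function, differentiation under the integral gives vt as a derivative of the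
    -- distribution-valued curve. One-sided derivatives on [0, ∞) are unique, hence vt agrees with
    -- ut almost everywhere.
    refine ae_eq_of_integral_contDiff_smul_eq (hreg.weakDeriv_tx t ht).1
      (hvtc t).locallyIntegrable fun φ hφ hs => ?_
    have h1 := hreg.weakDeriv_t φ hφ hs t ht
    obtain ⟨K, hK⟩ := (hs.isCompact.prod
      (isCompact_closedBall t 1)).exists_bound_of_continuousOn hvt.continuousOn
    have h2 := (hasDerivAt_integral_of_dominated_loc_of_deriv_le (μ := volume)
      (F := fun s x => v x s * φ x) (F' := fun s x => vt x s * φ x) (bound := fun x => K * ‖φ x‖)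
      (Metric.closedBall_mem_nhds t one_pos)
      (Eventually.of_forall fun s => ((hvc' s).mul hφ.continuous).aestronglyMeasurable)
      (((hvc' t).mul hφ.continuous).integrable_of_hasCompactSupport hs.mul_left)
      ((hvtc t).mul hφ.continuous).aestronglyMeasurable
      (Eventually.of_forall fun x s hs' => by
        rw [norm_mul]
        by_cases hx : x ∈ tsupport φ
        · exact mul_le_mul_of_nonneg_right (hK (x, s) ⟨hx, hs'⟩) (norm_nonneg _)
        · rw [image_eq_zero_of_notMem_tsupport hx]; simp)
      ((hφ.continuous.norm.integrable_of_hasCompactSupport hs.norm).const_mul K)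
      (Eventually.of_forall fun x s _ => (hdt x s).mul_const (φ x))).2
    have h3 : HasDerivWithinAt (fun s : ℝ => ∫ x, u x s * φ x) (∫ x, vt x t * φ x) (Set.Ici 0) t :=
      h2.hasDerivWithinAt.congr (fun s hs => by simp only [huv _ _ hs]) (by simp only [huv _ _ ht])
    have h4 := (uniqueDiffOn_Ici (0 : ℝ) t ht).eq_deriv _ h1 h3
    simpa only [smul_eq_mul, mul_comm (φ _)] using h4

/-! ### The scattering problem with continuous coefficients -/

/-- The integrated equation does not see changes of f' and g on null sets. Once the coefficients are
continuous, the fundamental theorem of calculus makes it the classical equation. -/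
lemma isEigenSolution_iff {ε : ℝ} (hε : ε ≠ 0) {P P' : Potential} (hf : P.f = P'.f)
    (hf' : ∀ᵐ x, P.f' x = P'.f' x) (hg : ∀ᵐ x, P.g x = P'.g x) {z : ℂ}
    (hc : Continuous (potMatrix ε P' z)) (w : ℝ → Fin 2 → ℂ) :
    IsEigenSolution ε P z w ↔ IsLinSol (linCoeff (specExp ε z) (potMatrix ε P' z)) w := by
  have hεc : (ε : ℂ) ≠ 0 := Complex.ofReal_ne_zero.2 hε
  have hk0 : 4 * Complex.I * (ε : ℂ) ≠ 0 := by simp [hεc]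
  have hL : ∀ x, matL ε P' z x =
      (4 * Complex.I * (ε : ℂ)) • linCoeff (specExp ε z) (potMatrix ε P' z) x := fun x => by
    rw [matL, linCoeff, potMatrix, smul_add, smul_smul, mul_inv_cancel₀ hk0, one_smul]
    congr 1
    ext i k
    fin_cases i <;> fin_cases k <;> simp [specExp] <;> field_simp <;> simp
  have hae : ∀ᵐ x, matL ε P z x =
      (4 * Complex.I * (ε : ℂ)) • linCoeff (specExp ε z) (potMatrix ε P' z) x := by
    filter_upwards [hf', hg] with x h1 h2
    rw [← hL, matL, matL, matQ, matQ, hf, h1, h2]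
  have hint : ∀ a b i, ∫ x in a..b, (matL ε P z x).mulVec (w x) i = 4 * Complex.I * ε *
      ∫ x in a..b, (linCoeff (specExp ε z) (potMatrix ε P' z) x).mulVec (w x) i := fun a b i => by
    rw [← intervalIntegral.integral_const_mul]
    refine intervalIntegral.integral_congr_ae (hae.mono fun x hx _ => ?_)
    rw [hx, Matrix.smul_mulVec]; rfl
  unfold IsEigenSolution
  simp only [hint, mul_right_inj' hk0]
  have hcc := continuous_linCoeff (lam := specExp ε z) hc
  constructor
  · rintro ⟨hw, h⟩ x
    rw [hasDerivAt_pi]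
    intro i
    have hF : Continuous fun x =>
        (linCoeff (specExp ε z) (potMatrix ε P' z) x).mulVec (w x) i :=
      (continuous_apply i).comp (hcc.matrix_mulVec hw)
    have h1 : (fun y => w y i) = fun y => w x i + ∫ r in x..y,
        (linCoeff (specExp ε z) (potMatrix ε P' z) r).mulVec (w r) i := by
      funext y; rw [← h x y i]; ring
    rw [h1]
    exact (intervalIntegral.integral_hasDerivAt_right (hF.intervalIntegrable _ _)
      (hF.stronglyMeasurableAtFilter _ _) hF.continuousAt).const_add _
  · intro h
    refine ⟨h.continuous, fun a b i => ?_⟩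
    have hF : Continuous fun x =>
        (linCoeff (specExp ε z) (potMatrix ε P' z) x).mulVec (w x) i :=
      (continuous_apply i).comp (hcc.matrix_mulVec h.continuous)
    exact (intervalIntegral.integral_eq_sub_of_hasDerivAt (fun x _ => hasDerivAt_pi.1 (h x) i)
      (hF.intervalIntegrable _ _)).symm

/-! ### Scattering data at a fixed time -/

/-- `A` is a continuous integrable traceless potential matrix such that the solutions of the
scattering problem are the classical solutions of `w' = (specExp σ₃ + A) w`. -/
structure IsRegularPotential (ε : ℝ) (P : Potential) (z : ℂ) (A : ℝ → Matrix (Fin 2) (Fin 2) ℂ) :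
    Prop where
  continuous : Continuous A
  integrable : ∀ i k, Integrable fun x => A x i k
  trace : ∀ x, A x 0 0 + A x 1 1 = 0
  isEigenSolution_iff : ∀ w, IsEigenSolution ε P z w ↔ IsLinSol (linCoeff (specExp ε z) A) w

/-- The end `l` at which the `k`-th Jost solution is normalized is one at which the exponential
factor of that solution is bounded. -/
def IsAdmissible (ε : ℝ) (z : ℂ) (k : Fin 2) (l : Filter ℝ) : Prop :=
  l = atTop ∧ (sigma3 k * specExp ε z).re ≤ 0 ∨ l = atBot ∧ 0 ≤ (sigma3 k * specExp ε z).re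

lemma IsAdmissible.eq_or {ε : ℝ} {z : ℂ} {k : Fin 2} {l : Filter ℝ} (h : IsAdmissible ε z k l) :
    l = atTop ∨ l = atBot := h.imp And.left And.left

lemma IsAdmissible.neBot {ε : ℝ} {z : ℂ} {k : Fin 2} {l : Filter ℝ} (h : IsAdmissible ε z k l) :
    l.NeBot := by
  rcases h.eq_or with rfl | rfl <;> infer_instance

lemma IsAdmissible.eventually {ε : ℝ} {z : ℂ} {k : Fin 2} {l : Filter ℝ}
    (h : IsAdmissible ε z k l) : ∀ᶠ x : ℝ in l, (sigma3 k * specExp ε z * x).re ≤ 0 := by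
  simp only [Complex.re_mul_ofReal]
  rcases h with ⟨rfl, h⟩ | ⟨rfl, h⟩
  · filter_upwards [eventually_ge_atTop 0] with x hx using mul_nonpos_of_nonpos_of_nonneg h hx
  · filter_upwards [eventually_le_atBot 0] with x hx using mul_nonpos_of_nonneg_of_nonpos h hx

/-- For ε > 0 and z ≠ 0 the sign of this real part is that of Im z, which decides at which end each
Jost solution is admissible. -/
lemma specExp_re (ε : ℝ) (z : ℂ) :
    (specExp ε z).re = z.im * (1 + (Complex.normSq z)⁻¹) / 4 / ε := by
  have : specExp ε z = ((ε⁻¹ : ℝ) : ℂ) * (((1 / 4 : ℝ) : ℂ) * (-(Complex.I * (z - z⁻¹)))) := by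
    unfold specExp specE; push_cast; ring
  rw [this, Complex.re_ofReal_mul, Complex.re_ofReal_mul]
  simp only [Complex.neg_re, Complex.mul_re, Complex.I_re, Complex.I_im, Complex.sub_re,
    Complex.sub_im, Complex.inv_im]
  ring

lemma specExp_re_nonpos {ε : ℝ} (hε : 0 < ε) {z : ℂ} (hz : z.im ≤ 0) : (specExp ε z).re ≤ 0 := by
  rw [specExp_re]
  have h : 0 ≤ (Complex.normSq z)⁻¹ := inv_nonneg.2 (Complex.normSq_nonneg z)
  exact div_nonpos_of_nonpos_of_nonneg (div_nonpos_of_nonpos_of_nonneg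
    (mul_nonpos_of_nonpos_of_nonneg hz (by positivity)) (by norm_num)) hε.le

lemma specExp_re_nonneg {ε : ℝ} (hε : 0 < ε) {z : ℂ} (hz : 0 ≤ z.im) : 0 ≤ (specExp ε z).re := by
  rw [specExp_re]
  have h : 0 ≤ (Complex.normSq z)⁻¹ := inv_nonneg.2 (Complex.normSq_nonneg z)
  positivity

lemma isAdmissible_zero_atTop {ε : ℝ} (hε : 0 < ε) {z : ℂ} (hz : z.im ≤ 0) :
    IsAdmissible ε z 0 atTop := Or.inl ⟨rfl, by simpa [sigma3] using specExp_re_nonpos hε hz⟩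

lemma isAdmissible_one_atBot {ε : ℝ} (hε : 0 < ε) {z : ℂ} (hz : z.im ≤ 0) :
    IsAdmissible ε z 1 atBot := Or.inr ⟨rfl, by simpa [sigma3] using specExp_re_nonpos hε hz⟩

lemma isAdmissible_zero_atBot {ε : ℝ} (hε : 0 < ε) {z : ℂ} (hz : 0 ≤ z.im) :
    IsAdmissible ε z 0 atBot := Or.inr ⟨rfl, by simpa [sigma3] using specExp_re_nonneg hε hz⟩

lemma isAdmissible_one_atTop {ε : ℝ} (hε : 0 < ε) {z : ℂ} (hz : 0 ≤ z.im) :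
    IsAdmissible ε z 1 atTop := Or.inl ⟨rfl, by simpa [sigma3] using specExp_re_nonneg hε hz⟩

namespace IsRegularPotential

variable {ε : ℝ} {P : Potential} {z : ℂ} {A : ℝ → Matrix (Fin 2) (Fin 2) ℂ} {k : Fin 2}
  {l : Filter ℝ}

lemma isJost_iff (h : IsRegularPotential ε P z A) (j : ℝ → Fin 2 → ℂ) :
    IsJost ε P z k l j ↔ IsNormalizedSol (specExp ε z) A k l j := by
  unfold IsJost IsNormalizedSol
  rw [h.isEigenSolution_iff]
  have : ∀ x : ℝ, sigma3 k * Complex.I * specE z * x / ε = -(sigma3 k * specExp ε z * x) :=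
    fun x => by unfold specExp; ring
  simp only [this]

lemma existsUnique_isJost (h : IsRegularPotential ε P z A) (hl : IsAdmissible ε z k l) :
    ∃! j, IsJost ε P z k l j := by
  have := hl.neBot
  obtain ⟨j, hj⟩ : ∃ j, IsNormalizedSol (specExp ε z) A k l j := by
    rcases hl with ⟨rfl, hl⟩ | ⟨rfl, hl⟩ <;> fin_cases k
    · exact exists_isNormalizedSol_zero_atTop (by simpa [sigma3] using hl) h.continuous h.integrable
    · exact exists_isNormalizedSol_one_atTop (by simpa [sigma3] using hl) h.continuous h.integrable
    · exact exists_isNormalizedSol_zero_atBot (by simpa [sigma3] using hl) h.continuous h.integrable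
    · exact exists_isNormalizedSol_one_atBot (by simpa [sigma3] using hl) h.continuous h.integrable
  exact ⟨j, (h.isJost_iff j).2 hj, fun j' hj' =>
    ((h.isJost_iff j').1 hj').unique h.continuous h.trace hl.eventually hj⟩

lemma isNormalizedSol_jost (h : IsRegularPotential ε P z A) (hl : IsAdmissible ε z k l) :
    IsNormalizedSol (specExp ε z) A k l (jost ε P z k l) :=
  (h.isJost_iff _).1 (Classical.epsilon_spec (h.existsUnique_isJost hl).exists)

lemma jost_eq (h : IsRegularPotential ε P z A) (hl : IsAdmissible ε z k l) {j : ℝ → Fin 2 → ℂ}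
    (hj : IsNormalizedSol (specExp ε z) A k l j) : jost ε P z k l = j :=
  have := hl.neBot
  (h.isNormalizedSol_jost hl).unique h.continuous h.trace hl.eventually hj

lemma wronskian_jost_eq (h : IsRegularPotential ε P z A) {k' : Fin 2} {l' : Filter ℝ}
    (hl : IsAdmissible ε z k l) (hl' : IsAdmissible ε z k' l') (x y : ℝ) :
    wronskian (jost ε P z k l x) (jost ε P z k' l' x) =
      wronskian (jost ε P z k l y) (jost ε P z k' l' y) :=
  (h.isNormalizedSol_jost hl).1.wronskian_eq (linCoeff_trace h.trace)
    (h.isNormalizedSol_jost hl').1 x y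

/-- The scattering matrix in terms of Wronskians. -/
lemma isScatteringMatrix_iff (hε : 0 < ε) {z : ℝ} (h : IsRegularPotential ε P z A) (x : ℝ)
    (S : Matrix (Fin 2) (Fin 2) ℂ) : IsScatteringMatrix ε P z S ↔
      S = Matrix.of fun i k => if i = 0
        then wronskian (jost ε P z k atTop x) (jost ε P z 1 atBot x)
        else wronskian (jost ε P z 0 atBot x) (jost ε P z k atTop x) := by
  have him : (z : ℂ).im = 0 := Complex.ofReal_im z
  have hl0 := isAdmissible_zero_atBot hε him.ge
  have hl1 := isAdmissible_one_atBot hε him.le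
  have hk : ∀ k, IsAdmissible ε z k atTop := Fin.forall_fin_two.2
    ⟨isAdmissible_zero_atTop hε him.le, isAdmissible_one_atTop hε him.ge⟩
  have hw : ∀ y, wronskian (jost ε P z 0 atBot y) (jost ε P z 1 atBot y) = 1 :=
    (h.isNormalizedSol_jost hl0).wronskian_eq_one h.trace (h.isNormalizedSol_jost hl1)
  constructor
  · intro hS
    have hc : ∀ i k, jost ε P z k atTop x i =
        jost ε P z 0 atBot x i * S 0 k + jost ε P z 1 atBot x i * S 1 k := fun i k => by
      have := congrFun (congrFun (hS x) i) k
      simpa [jostMatrix, Matrix.mul_apply, Fin.sum_univ_two] using this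
    have hwx := hw x
    ext i k
    simp only [wronskian] at hwx
    fin_cases i
    · simp only [Fin.zero_eta, Matrix.of_apply, if_true, wronskian, hc]
      -- Cramer's rule for the matrix J⁻, whose determinant is 1.
      linear_combination -S 0 k * hwx
    · simp only [Fin.mk_one, Matrix.of_apply, one_ne_zero, if_false, wronskian, hc]
      linear_combination -S 1 k * hwx
  · rintro rfl y
    ext i k
    have hwy := hw y
    simp only [jostMatrix, Matrix.mul_apply, Fin.sum_univ_two, Matrix.of_apply, if_true,
      one_ne_zero, if_false]
    rw [h.wronskian_jost_eq (hk k) hl1 x y, h.wronskian_jost_eq hl0 (hk k) x y]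
    simp only [wronskian] at hwy ⊢
    fin_cases i
    · simp only [Fin.zero_eta]
      linear_combination -jost ε P z k atTop y 0 * hwy
    · simp only [Fin.mk_one]
      linear_combination -jost ε P z k atTop y 1 * hwy

lemma existsUnique_isScatteringMatrix (hε : 0 < ε) {z : ℝ} (h : IsRegularPotential ε P z A) :
    ∃! S, IsScatteringMatrix ε P z S :=
  ⟨_, (h.isScatteringMatrix_iff hε 0 _).2 rfl, fun S hS => (h.isScatteringMatrix_iff hε 0 S).1 hS⟩

lemma scatteringMatrix_eq (hε : 0 < ε) {z : ℝ} (h : IsRegularPotential ε P z A) (x : ℝ) :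
    scatteringMatrix ε P z = Matrix.of fun i k => if i = 0
        then wronskian (jost ε P z k atTop x) (jost ε P z 1 atBot x)
        else wronskian (jost ε P z 0 atBot x) (jost ε P z k atTop x) :=
  (h.isScatteringMatrix_iff hε x _).1
    (Classical.epsilon_spec (h.existsUnique_isScatteringMatrix hε).exists)

/-- At an eigenvalue in the upper half-plane the two decaying Jost solutions are proportional. -/
lemma existsUnique_isPropConst (hε : 0 < ε) (h : IsRegularPotential ε P z A) (hz : 0 < z.im)
    (he : IsEigenvalue ε P z) : (∃! η, IsPropConst ε P z η) ∧ ∀ η, IsPropConst ε P z η → η ≠ 0 := by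
  obtain ⟨-, w, hw, hw0, hw2⟩ := he
  rw [h.isEigenSolution_iff] at hw
  have hl0 := isAdmissible_zero_atBot hε hz.le
  have hl1 := isAdmissible_one_atTop hε hz.le
  have h0 := h.isNormalizedSol_jost hl0
  have h1 := h.isNormalizedSol_jost hl1
  -- The eigenfunction is a multiple of each of the two Jost solutions, so they are proportional to
  -- each other with constant a⁻¹ b.
  obtain ⟨a, rfl⟩ := h0.exists_eq_smul_of_memLp h.continuous h.trace hl0.eq_or hl0.eventually hw hw2
  obtain ⟨b, hb⟩ := h1.exists_eq_smul_of_memLp h.continuous h.trace hl1.eq_or hl1.eventually hw hw2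
  have ha : a ≠ 0 := by
    rintro rfl
    exact hw0 (by funext x; simp)
  obtain ⟨x, hx⟩ := Function.ne_iff.1 h1.ne_zero
  have hne : ∀ η, IsPropConst ε P z η → η ≠ 0 := by
    rintro η hη rfl
    exact h0.ne_zero (funext fun x => by simpa using hη x)
  refine ⟨⟨a⁻¹ * b, fun y => ?_, fun η hη => ?_⟩, hne⟩
  · have : a • jost ε P z 0 atBot y = b • jost ε P z 1 atTop y := congrFun hb y
    rw [mul_smul, ← this, smul_smul, inv_mul_cancel₀ ha, one_smul]
  · have h2 : (a * η) • jost ε P z 1 atTop x = b • jost ε P z 1 atTop x := by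
      rw [mul_smul, ← hη x]; exact congrFun hb x
    have h3 := smul_left_injective ℂ hx h2
    rw [← h3, ← mul_assoc, inv_mul_cancel₀ ha, one_mul]

end IsRegularPotential

/-! ### Time evolution of the scattering data -/

lemma wronskian_mulVec (T : Matrix (Fin 2) (Fin 2) ℂ) (v w : Fin 2 → ℂ) :
    wronskian (T.mulVec v) (T.mulVec w) = T.det * wronskian v w := by
  simp only [wronskian, Matrix.mulVec, dotProduct, Fin.sum_univ_two, Matrix.det_fin_two]
  ring

/-- For determinant 1 the inverse is the adjugate, whose entries are those of T up to sign and
position; the factor 2 counts the entries of a row. -/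
lemma norm_inv_mulVec_le {T : Matrix (Fin 2) (Fin 2) ℂ} (hdet : T.det = 1) {K : ℝ}
    (hT : ∀ v, ‖T.mulVec v‖ ≤ K * ‖v‖) (v : Fin 2 → ℂ) : ‖T⁻¹.mulVec v‖ ≤ 2 * K * ‖v‖ := by
  have hK : ∀ i k, ‖T i k‖ ≤ K := fun i k => by
    have h := (norm_le_pi_norm (T.mulVec (Pi.single k 1)) i).trans (hT (Pi.single k 1))
    rw [Pi.norm_single, norm_one, mul_one] at h
    simpa using h
  have hK0 : 0 ≤ K := (norm_nonneg _).trans (hK 0 0)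
  have h2 : ∀ a b : ℂ, ‖a‖ ≤ K → ‖b‖ ≤ K → ‖a * v 0 + b * v 1‖ ≤ 2 * K * ‖v‖ := fun a b ha hb => by
    calc _ ≤ ‖a‖ * ‖v 0‖ + ‖b‖ * ‖v 1‖ := by
          rw [← norm_mul, ← norm_mul]; exact norm_add_le _ _
      _ ≤ K * ‖v‖ + K * ‖v‖ := by gcongr <;> exact norm_le_pi_norm _ _
      _ = _ := by ring
  rw [Matrix.inv_def, hdet, Ring.inverse_one, one_smul, Matrix.adjugate_fin_two,
    pi_norm_le_iff_of_nonneg (by positivity), Fin.forall_fin_two]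
  constructor
  · simpa [Matrix.mulVec, dotProduct, Fin.sum_univ_two] using
      h2 (T 1 1) (-T 0 1) (hK 1 1) (by simpa using hK 0 1)
  · simpa [Matrix.mulVec, dotProduct, Fin.sum_univ_two] using
      h2 (-T 1 0) (T 0 0) (by simpa using hK 1 0) (hK 0 0)

/-- A weak solution with `L¹`-Sobolev regularity tends to `2 π ℤ` at both ends. -/
lemma tendsto_charMatrix {ε : ℝ} {z : ℂ} {v vx : ℝ → ℝ} (hd : ∀ x, HasDerivAt v (vx x) x)
    (hc : Integrable fun x => 1 - Real.cos (v x)) (hs : Integrable fun x => Real.sin (v x))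
    (hx : Integrable vx) {l : Filter ℝ} (hl : l = atTop ∨ l = atBot) :
    Tendsto (fun x => charMatrix ε z (v x)) l (𝓝 (charMatrix ε z 0)) := by
  have hv : Continuous v := continuous_iff_continuousAt.2 fun x => (hd x).continuousAt
  have hd1 : ∀ x, HasDerivAt (fun x => 1 - Real.cos (v x)) (vx x * Real.sin (v x)) x := fun x =>
    ((hd x).cos.const_sub 1).congr_deriv (by ring)
  have hd2 : ∀ x, HasDerivAt (fun x => Real.sin (v x)) (vx x * Real.cos (v x)) x := fun x =>
    (hd x).sin.congr_deriv (by ring)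
  have hi1 : Integrable fun x => vx x * Real.sin (v x) :=
    hx.mul_bdd (c := 1) (Real.continuous_sin.comp hv).aestronglyMeasurable
      (Eventually.of_forall fun x => Real.abs_sin_le_one _)
  have hi2 : Integrable fun x => vx x * Real.cos (v x) :=
    hx.mul_bdd (c := 1) (Real.continuous_cos.comp hv).aestronglyMeasurable
      (Eventually.of_forall fun x => Real.abs_cos_le_one _)
  -- A function that is integrable together with its derivative tends to zero at infinity.
  have h : Tendsto (fun x => 1 - Real.cos (v x)) l (𝓝 0) ∧
      Tendsto (fun x => Real.sin (v x)) l (𝓝 0) := by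
    rcases hl with rfl | rfl
    · exact ⟨tendsto_zero_of_hasDerivAt_of_integrableOn_Ioi (a := 0) (fun x _ => hd1 x)
        hi1.integrableOn hc.integrableOn, tendsto_zero_of_hasDerivAt_of_integrableOn_Ioi (a := 0)
        (fun x _ => hd2 x) hi2.integrableOn hs.integrableOn⟩
    · exact ⟨tendsto_zero_of_hasDerivAt_of_integrableOn_Iic (a := 0) (fun x _ => hd1 x)
        hi1.integrableOn hc.integrableOn, tendsto_zero_of_hasDerivAt_of_integrableOn_Iic (a := 0)
        (fun x _ => hd2 x) hi2.integrableOn hs.integrableOn⟩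
  have hcos : Tendsto (fun x => Real.cos (v x)) l (𝓝 (Real.cos 0)) := by
    simpa using h.1.const_sub 1
  have hsin : Tendsto (fun x => Real.sin (v x)) l (𝓝 (Real.sin 0)) := by simpa using h.2
  simp only [charMatrix_eq]
  exact (hcos.smul_const _).add (hsin.smul_const _)

/-- Transport of the solutions of the scattering problem from time `0` to time `t`. -/
structure IsTransport (ε : ℝ) (z : ℂ) (t : ℝ) (A₀ A : ℝ → Matrix (Fin 2) (Fin 2) ℂ)
    (T : ℝ → Matrix (Fin 2) (Fin 2) ℂ) : Prop where
  det : ∀ c, (T c).det = 1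
  norm_le : ∃ K, ∀ c v, ‖(T c).mulVec v‖ ≤ K * ‖v‖
  isLinSol_iff : ∀ w, IsLinSol (linCoeff (specExp ε z) A) (fun x => (T (x + t)).mulVec (w (x + t)))
    ↔ IsLinSol (linCoeff (specExp ε z) A₀) w
  isNormalizedSol : ∀ k l j, (l = atTop ∨ l = atBot) → IsNormalizedSol (specExp ε z) A₀ k l j →
    IsNormalizedSol (specExp ε z) A k l (fun x =>
      Complex.exp (sigma3 k * Complex.I * specD z * t / ε) • (T (x + t)).mulVec (j (x + t)))

/-- This is where D enters. The part -`specExp` compensates the displacement from x + t to x in the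
normalizing exponential, and what remains is the phase of the time evolution. -/
lemma charMatrix_eigenvalue (ε : ℝ) (z : ℂ) :
    (2 * Complex.I * ε)⁻¹ * z⁻¹ = -specExp ε z - Complex.I * specD z / ε := by
  rw [mul_inv, mul_inv, Complex.inv_I]
  unfold specExp specE specD
  ring

lemma charMatrix_zero_mulVec_single (ε : ℝ) (z : ℂ) (k : Fin 2) :
    (charMatrix ε z 0).mulVec (Pi.single k 1) =
      (sigma3 k * ((2 * Complex.I * ε)⁻¹ * z⁻¹)) • (Pi.single k 1 : Fin 2 → ℂ) := by
  ext i
  fin_cases k <;> fin_cases i <;> simp [charMatrix, sigma3]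

/-- T(c) is the propagator from time 0 to time t along x + t = c. Zero curvature makes it respect
the scattering problem, tracelessness gives the determinant, Grönwall the bound, and the limit of
`charMatrix` at both ends the effect on the normalization. -/
theorem IsCharacteristicSol.exists_isTransport {ε : ℝ} (hε : 0 < ε) {v vx vt : ℝ → ℝ → ℝ}
    (hv : IsCharacteristicSol ε v vx vt)
    (hc : ∀ t, 0 ≤ t → Integrable fun x => 1 - Real.cos (v x t))
    (hs : ∀ t, 0 ≤ t → Integrable fun x => Real.sin (v x t))
    (hx : ∀ t, 0 ≤ t → Integrable fun x => vx x t) {z : ℂ} (hz : z ≠ 0) {t : ℝ} (ht : 0 ≤ t) :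
    ∃ T, IsTransport ε z t (potMatrix ε (potentialAt ε v vx vt 0) z)
      (potMatrix ε (potentialAt ε v vx vt t) z) T := by
  have hM : Continuous fun p : ℝ × ℝ => charMatrix ε z (v (p.1 - p.2) p.2) :=
    (continuous_charMatrix ε z).comp
      (hv.cont_u.comp (by fun_prop : Continuous fun p : ℝ × ℝ => (p.1 - p.2, p.2)))
  have hprop : ∀ c, ∃ T : ℝ → Matrix (Fin 2) (Fin 2) ℂ, T 0 = 1 ∧ (∀ s, (T s).det = 1) ∧
      ∀ s ∈ Set.Icc 0 t, ∀ w, HasDerivAt (fun s => (T s).mulVec w)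
        ((charMatrix ε z (v (c - s) s)).mulVec ((T s).mulVec w)) s := fun c => by
    have hMc := hM.comp (by fun_prop : Continuous fun s : ℝ => (c, s))
    simp only [Function.comp_def] at hMc
    exact exists_propagator hMc (fun s => charMatrix_trace ε z _) t
  choose T hT0 hTdet hTd using hprop
  obtain ⟨K, hK1, hK⟩ := exists_norm_charMatrix_le ε z
  have htm : t ∈ Set.Icc 0 t := ⟨ht, le_rfl⟩
  have hlin : ∀ w, IsLinSol (linCoeff (specExp ε z) (potMatrix ε (potentialAt ε v vx vt t) z))
      (fun x => (T (x + t) t).mulVec (w (x + t))) ↔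
      IsLinSol (linCoeff (specExp ε z) (potMatrix ε (potentialAt ε v vx vt 0) z)) w := fun w => by
    have := hv.isLinSol_iff hε.ne' hz ht (a := fun c s => (T c s).mulVec (w c))
      (fun c s hs => hTd c s hs (w c))
    simpa only [hT0, Matrix.one_mulVec] using this
  have hnorm : ∀ c w, ‖(T c t).mulVec w‖ ≤ Real.exp (K * t) * ‖w‖ := fun c w => by
    have := norm_le_mul_exp_of_deriv_le hK1 le_rfl (fun s hs => hTd c s hs w)
      (fun s _ => by
        rw [add_zero]
        exact (Matrix.linfty_opNorm_mulVec _ _).trans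
          (mul_le_mul_of_nonneg_right (hK _) (norm_nonneg _))) htm
    rw [hT0, Matrix.one_mulVec, add_zero, mul_comm] at this
    exact this
  have hasymp : ∀ (k : Fin 2) (l : Filter ℝ) (j : ℝ → Fin 2 → ℂ), (l = atTop ∨ l = atBot) →
      Tendsto (fun c : ℝ => Complex.exp (-(sigma3 k * specExp ε z * c)) • j c) l
        (𝓝 (Pi.single k 1)) →
      Tendsto (fun x : ℝ => Complex.exp (-(sigma3 k * specExp ε z * x)) •
        Complex.exp (sigma3 k * Complex.I * specD z * t / ε) • (T (x + t) t).mulVec (j (x + t))) l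
        (𝓝 (Pi.single k 1)) := by
    intro k l j hl hj
    have : l.IsCountablyGenerated := by rcases hl with rfl | rfl <;> infer_instance
    have hshift : ∀ s : ℝ, Tendsto (fun c => c - s) l l := fun s => by
      rcases hl with rfl | rfl
      · exact tendsto_atTop_add_const_right _ _ tendsto_id
      · exact tendsto_atBot_add_const_right _ _ tendsto_id
    have hshift' : Tendsto (fun x => x + t) l l := by simpa using hshift (-t)
    have hlimM : ∀ s ∈ Set.Icc 0 t, Tendsto (fun c => charMatrix ε z (v (c - s) s)) l
        (𝓝 (charMatrix ε z 0)) := fun s h =>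
      (tendsto_charMatrix (fun x => hv.deriv_x x s) (hc s h.1) (hs s h.1) (hx s h.1) hl).comp
        (hshift s)
    have hlim := tendsto_param ht hK1 hM (fun c s _ => hK _)
      (a := fun c s => (T c s).mulVec (j c)) (fun c s hs => hTd c s hs (j c))
      hlimM (charMatrix_zero_mulVec_single ε z k)
      (f := fun c => Complex.exp (-(sigma3 k * specExp ε z * c)))
      (by simpa only [hT0, Matrix.one_mulVec] using hj)
    -- The limit along c = x + t carries the factor exp(σ t / (2 i ε z)), with σ = ±1 the entry of
    -- σ₃. It is divided out, and the exponents are then compared after replacing c by x + t.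
    have h2 := (hlim.comp hshift').const_smul
      (Complex.exp (-(sigma3 k * ((2 * Complex.I * ε)⁻¹ * z⁻¹) * t)))
    rw [smul_smul, ← Complex.exp_add, neg_add_cancel, Complex.exp_zero, one_smul] at h2
    refine h2.congr fun x => ?_
    simp only [Function.comp_def, smul_smul, ← Complex.exp_add]
    congr 2
    push_cast
    linear_combination -(sigma3 k * t) * charMatrix_eigenvalue ε z
  exact ⟨fun c => T c t, fun c => hTdet c t, ⟨Real.exp (K * t), hnorm⟩, hlin,
    fun k l j hl hj => ⟨((hlin j).2 hj.1).smul _, hasymp k l j hl hj.2⟩⟩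

namespace IsTransport

variable {ε : ℝ} {z : ℂ} {t : ℝ} {P₀ P : Potential} {A₀ A T : ℝ → Matrix (Fin 2) (Fin 2) ℂ}

lemma jost_eq (hT : IsTransport ε z t A₀ A T) (h₀ : IsRegularPotential ε P₀ z A₀)
    (h : IsRegularPotential ε P z A) {k : Fin 2} {l : Filter ℝ} (hl : IsAdmissible ε z k l)
    (x : ℝ) : jost ε P z k l x = Complex.exp (sigma3 k * Complex.I * specD z * t / ε) •
      (T (x + t)).mulVec (jost ε P₀ z k l (x + t)) :=
  congrFun (h.jost_eq hl (hT.isNormalizedSol k l _ hl.eq_or (h₀.isNormalizedSol_jost hl))) x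

/-- Since det T = 1, only the normalizing factors of the two Jost solutions change the Wronskian:
their exponents cancel for different columns and double for equal ones. -/
lemma wronskian_jost_eq (hT : IsTransport ε z t A₀ A T) (h₀ : IsRegularPotential ε P₀ z A₀)
    (h : IsRegularPotential ε P z A) {k k' : Fin 2} {l l' : Filter ℝ} (hl : IsAdmissible ε z k l)
    (hl' : IsAdmissible ε z k' l') (x y : ℝ) :
    wronskian (jost ε P z k l x) (jost ε P z k' l' x) =
      wronskian (jost ε P₀ z k l y) (jost ε P₀ z k' l' y) *
        Complex.exp ((sigma3 k + sigma3 k') * (Complex.I * specD z * t / ε)) := by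
  rw [hT.jost_eq h₀ h hl, hT.jost_eq h₀ h hl', wronskian_smul_smul, wronskian_mulVec, hT.det,
    one_mul, h₀.wronskian_jost_eq hl hl' (x + t) y, ← Complex.exp_add, mul_comm]
  congr 2
  ring

/-- T and its inverse are bounded uniformly in c and translation preserves Lebesgue measure, so
square-integrable solutions correspond in both directions. -/
lemma isEigenvalue_iff (hT : IsTransport ε z t A₀ A T) (h₀ : IsRegularPotential ε P₀ z A₀)
    (h : IsRegularPotential ε P z A) : IsEigenvalue ε P z ↔ IsEigenvalue ε P₀ z := by
  obtain ⟨K, hK⟩ := hT.norm_le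
  have hdet : ∀ c, IsUnit (T c).det := fun c => by rw [hT.det]; exact isUnit_one
  unfold IsEigenvalue
  simp only [h₀.isEigenSolution_iff, h.isEigenSolution_iff]
  refine and_congr_right fun _ => ⟨?_, ?_⟩
  · rintro ⟨w, hw, hw0, hw2⟩
    have hcancel : (fun x => (T (x + t)).mulVec ((T (x + t))⁻¹.mulVec (w (x + t - t)))) = w := by
      funext x
      rw [Matrix.mulVec_mulVec, Matrix.mul_nonsing_inv _ (hdet _), Matrix.one_mulVec,
        add_sub_cancel_right]
    have hsol : IsLinSol (linCoeff (specExp ε z) A₀) (fun c => (T c)⁻¹.mulVec (w (c - t))) :=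
      (hT.isLinSol_iff _).1 (by rw [hcancel]; exact hw)
    refine ⟨_, hsol, fun h0 => hw0 ?_, ?_⟩
    · rw [← hcancel]
      funext x
      rw [show (T (x + t))⁻¹.mulVec (w (x + t - t)) = 0 from congrFun h0 (x + t)]
      simp
    · exact (hw2.comp_measurePreserving (measurePreserving_sub_right volume t)).of_le_mul
        hsol.continuous.aestronglyMeasurable
        (Eventually.of_forall fun c => norm_inv_mulVec_le (hT.det c) (hK c) _)
  · rintro ⟨w, hw, hw0, hw2⟩
    have hsol := (hT.isLinSol_iff w).2 hw
    refine ⟨_, hsol, fun h0 => hw0 ?_, ?_⟩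
    · funext c
      have := congrFun h0 (c - t)
      simp only [sub_add_cancel] at this
      have h2 := congrArg ((T c)⁻¹.mulVec) this
      rw [Matrix.mulVec_mulVec, Matrix.nonsing_inv_mul _ (hdet _), Matrix.one_mulVec] at h2
      rw [h2]; simp
    · exact (hw2.comp_measurePreserving (measurePreserving_add_right volume t)).of_le_mul
        hsol.continuous.aestronglyMeasurable (Eventually.of_forall fun c => hK _ _)

lemma isPropConst (hε : 0 < ε) (hT : IsTransport ε z t A₀ A T)
    (h₀ : IsRegularPotential ε P₀ z A₀) (h : IsRegularPotential ε P z A) (hz : 0 ≤ z.im) {η : ℂ}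
    (hη : IsPropConst ε P₀ z η) :
    IsPropConst ε P z (η * Complex.exp (2 * Complex.I * specD z * t / ε)) := fun x => by
  rw [hT.jost_eq h₀ h (isAdmissible_zero_atBot hε hz),
    hT.jost_eq h₀ h (isAdmissible_one_atTop hε hz), hη, Matrix.mulVec_smul, smul_smul, smul_smul,
    mul_assoc η, ← Complex.exp_add, mul_comm]
  congr 3
  simp [sigma3]; ring

end IsTransport

/-- The C¹ representative supplies continuity of the potential, and the L¹ hypotheses supply its
integrability. -/
lemma IsCharacteristicSol.isRegularPotential {ε : ℝ} (hε : 0 < ε) {u ux uxx ut utx : ℝ → ℝ → ℝ}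
    (hreg : HasL1SobolevRegularity u ux uxx ut utx) {v vx vt : ℝ → ℝ → ℝ}
    (hv : IsCharacteristicSol ε v vx vt) {t : ℝ} (ht : 0 ≤ t) (huv : ∀ x, u x t = v x t)
    (hx : ∀ᵐ x, ux x t = vx x t) (hut : ∀ᵐ x, ut x t = vt x t) (z : ℂ) :
    IsRegularPotential ε (potentialAt ε u ux ut t) z
      (potMatrix ε (potentialAt ε v vx vt t) z) := by
  have hφ : Continuous fun x : ℝ => (x, t) := by fun_prop
  have cu : Continuous fun x => v x t := hv.cont_u.comp hφ
  have cx : Continuous fun x => vx x t := hv.cont_ux.comp hφ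
  have ct : Continuous fun x => vt x t := hv.cont_ut.comp hφ
  have hQ : Continuous (matQ ε (potentialAt ε v vx vt t) z) := by
    unfold matQ potentialAt
    refine continuous_matrix fun i k => ?_
    fin_cases i <;> fin_cases k <;> simp <;> fun_prop
  have hpot : Continuous (potMatrix ε (potentialAt ε v vx vt t) z) :=
    hQ.fun_const_smul (4 * Complex.I * (ε : ℂ))⁻¹
  have h1 : Integrable fun x => ((1 - Real.cos (v x t) : ℝ) : ℂ) := by
    have := hreg.integrable_cos t ht
    simp only [huv] at this
    exact this.ofReal
  have h2 : Integrable fun x => ((Real.sin (v x t) : ℝ) : ℂ) := by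
    have := hreg.integrable_sin t ht
    simp only [huv] at this
    exact this.ofReal
  have h3 : Integrable fun x => ((ε * vx x t + ε * vt x t : ℝ) : ℂ) :=
    ((((hreg.integrable_ux t ht).congr hx).const_mul ε).add
      (((hreg.integrable_ut t ht).congr hut).const_mul ε)).ofReal
  push_cast at h1 h2 h3
  refine ⟨hpot, fun i k => ?_, potMatrix_trace ε _ z, fun w => ?_⟩
  · refine Integrable.const_mul (f := fun x => matQ ε (potentialAt ε v vx vt t) z x i k) ?_ _
    fin_cases i <;> fin_cases k <;> simp [matQ, potentialAt]
    · exact h1.const_mul _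
    · exact ((h2.const_mul z⁻¹).neg).sub (h3.const_mul Complex.I)
    · exact ((h2.const_mul z⁻¹).neg).add (h3.const_mul Complex.I)
    · exact h1.const_mul z⁻¹
  · exact SineGordon.isEigenSolution_iff hε.ne' (funext huv) hx
      (hut.mono fun x h => by simp only [potentialAt, h]) hpot w

end SineGordon

theorem mainTheorem7 (ε : ℝ) (hε : 0 < ε) (u ux uxx ut utx : ℝ → ℝ → ℝ)
    (hsol : IsWeakSolution ε u (fun x => ut x 0))
    (hreg : HasL1SobolevRegularity u ux uxx ut utx)
    (P : ℝ → Potential) (hP : P = potentialAt ε u ux ut) :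
    -- the scattering data at each time are well defined
    (∀ t : ℝ, 0 ≤ t → ∀ z : ℂ, z ≠ 0 →
      (z.im ≤ 0 → (∃! j, IsJost ε (P t) z 0 atTop j) ∧ (∃! j, IsJost ε (P t) z 1 atBot j)) ∧
      (0 ≤ z.im → (∃! j, IsJost ε (P t) z 0 atBot j) ∧ (∃! j, IsJost ε (P t) z 1 atTop j))) ∧
    (∀ t : ℝ, 0 ≤ t → ∀ z : ℝ, z ≠ 0 →
      (∃! S, IsScatteringMatrix ε (P t) z S) ∧
      (∀ x : ℝ, scatteringMatrix ε (P t) z 0 0 = extS11 ε (P t) z x) ∧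
      (∀ x : ℝ, scatteringMatrix ε (P t) z 1 1 = extS22 ε (P t) z x)) ∧
    -- the diagonal entries, with their extensions to half-planes, do not depend on time
    (∀ t : ℝ, 0 ≤ t → ∀ z : ℝ, z ≠ 0 →
      scatteringMatrix ε (P t) z 0 0 = scatteringMatrix ε (P 0) z 0 0 ∧
      scatteringMatrix ε (P t) z 1 1 = scatteringMatrix ε (P 0) z 1 1) ∧
    (∀ t : ℝ, 0 ≤ t → ∀ z : ℂ, z ≠ 0 → ∀ x y : ℝ,
      (z.im ≤ 0 → extS11 ε (P t) z x = extS11 ε (P 0) z y) ∧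
      (0 ≤ z.im → extS22 ε (P t) z x = extS22 ε (P 0) z y)) ∧
    -- the eigenvalues do not depend on time
    (∀ t : ℝ, 0 ≤ t → ∀ z : ℂ, IsEigenvalue ε (P t) z ↔ IsEigenvalue ε (P 0) z) ∧
    -- the off-diagonal entries
    (∀ t : ℝ, 0 ≤ t → ∀ z : ℝ, z ≠ 0 →
      scatteringMatrix ε (P t) z 0 1 =
        scatteringMatrix ε (P 0) z 0 1 * Complex.exp (-2 * Complex.I * specD z * t / ε) ∧
      scatteringMatrix ε (P t) z 1 0 =
        scatteringMatrix ε (P 0) z 1 0 * Complex.exp (2 * Complex.I * specD z * t / ε)) ∧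
    -- the proportionality constants
    (∀ z : ℂ, 0 < z.im → IsEigenvalue ε (P 0) z → ∀ t : ℝ, 0 ≤ t →
      (∃! η, IsPropConst ε (P t) z η) ∧ propConst ε (P t) z ≠ 0 ∧
      propConst ε (P t) z =
        propConst ε (P 0) z * Complex.exp (2 * Complex.I * specD z * t / ε)) := by
  obtain ⟨v, vx, vt, hv, huv, hae⟩ := exists_isCharacteristicSol hsol hreg
  have hc : ∀ t, 0 ≤ t → Integrable fun x => 1 - Real.cos (v x t) := fun t ht => by
    simpa only [huv _ t ht] using hreg.integrable_cos t ht
  have hs : ∀ t, 0 ≤ t → Integrable fun x => Real.sin (v x t) := fun t ht => by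
    simpa only [huv _ t ht] using hreg.integrable_sin t ht
  have hx : ∀ t, 0 ≤ t → Integrable fun x => vx x t := fun t ht =>
    (hreg.integrable_ux t ht).congr (hae t ht).1
  set A : ℝ → ℂ → ℝ → Matrix (Fin 2) (Fin 2) ℂ :=
    fun t z => potMatrix ε (potentialAt ε v vx vt t) z
  have hA : ∀ t, 0 ≤ t → ∀ z, IsRegularPotential ε (P t) z (A t z) := fun t ht z => by
    rw [hP]
    exact hv.isRegularPotential hε hreg ht (fun x => huv x t ht) (hae t ht).1 (hae t ht).2 z
  have hT : ∀ t, 0 ≤ t → ∀ z, z ≠ 0 → ∃ T, IsTransport ε z t (A 0 z) (A t z) T :=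
    fun t ht z hz => hv.exists_isTransport hε hc hs hx hz ht
  have hA0 := hA 0 le_rfl
  have h11 : ∀ t : ℝ, 0 ≤ t → ∀ z : ℂ, z ≠ 0 → ∀ x y : ℝ, z.im ≤ 0 →
      extS11 ε (P t) z x = extS11 ε (P 0) z y := fun t ht z hz x y him => by
    obtain ⟨T, hT⟩ := hT t ht z hz
    have := hT.wronskian_jost_eq (hA0 z) (hA t ht z) (isAdmissible_zero_atTop hε him)
      (isAdmissible_one_atBot hε him) x y
    simpa [sigma3, extS11, extS22] using this
  have h22 : ∀ t : ℝ, 0 ≤ t → ∀ z : ℂ, z ≠ 0 → ∀ x y : ℝ, 0 ≤ z.im →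
      extS22 ε (P t) z x = extS22 ε (P 0) z y := fun t ht z hz x y him => by
    obtain ⟨T, hT⟩ := hT t ht z hz
    have := hT.wronskian_jost_eq (hA0 z) (hA t ht z) (isAdmissible_zero_atBot hε him)
      (isAdmissible_one_atTop hε him) x y
    simpa [sigma3, extS11, extS22] using this
  have hS11 : ∀ t : ℝ, 0 ≤ t → ∀ z x : ℝ,
      scatteringMatrix ε (P t) z 0 0 = extS11 ε (P t) z x := fun t ht z x => by
    rw [(hA t ht z).scatteringMatrix_eq hε x]; rfl
  have hS22 : ∀ t : ℝ, 0 ≤ t → ∀ z x : ℝ,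
      scatteringMatrix ε (P t) z 1 1 = extS22 ε (P t) z x := fun t ht z x => by
    rw [(hA t ht z).scatteringMatrix_eq hε x]; rfl
  have heig : ∀ t : ℝ, 0 ≤ t → ∀ z : ℂ, IsEigenvalue ε (P t) z ↔ IsEigenvalue ε (P 0) z :=
    fun t ht z => by
      by_cases hz : z = 0
      · exact ⟨fun h => absurd hz h.1, fun h => absurd hz h.1⟩
      · obtain ⟨T, hT⟩ := hT t ht z hz
        exact hT.isEigenvalue_iff (hA0 z) (hA t ht z)
  refine ⟨fun t ht z _ => ⟨fun him => ⟨(hA t ht z).existsUnique_isJost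
      (isAdmissible_zero_atTop hε him), (hA t ht z).existsUnique_isJost
      (isAdmissible_one_atBot hε him)⟩, fun him => ⟨(hA t ht z).existsUnique_isJost
      (isAdmissible_zero_atBot hε him), (hA t ht z).existsUnique_isJost
      (isAdmissible_one_atTop hε him)⟩⟩,
    fun t ht z _ => ⟨(hA t ht z).existsUnique_isScatteringMatrix hε, hS11 t ht z, hS22 t ht z⟩,
    fun t ht z hz => ?_, fun t ht z hz x y => ⟨h11 t ht z hz x y, h22 t ht z hz x y⟩, heig,
    fun t ht z hz => ?_, fun z him he t ht => ?_⟩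
  · have hzc : (z : ℂ) ≠ 0 := Complex.ofReal_ne_zero.2 hz
    rw [hS11 t ht z 0, hS11 0 le_rfl z 0, hS22 t ht z 0, hS22 0 le_rfl z 0]
    exact ⟨h11 t ht z hzc 0 0 (Complex.ofReal_im z).le, h22 t ht z hzc 0 0 (Complex.ofReal_im z).ge⟩
  · obtain ⟨T, hT⟩ := hT t ht z (Complex.ofReal_ne_zero.2 hz)
    have him := Complex.ofReal_im z
    rw [(hA t ht z).scatteringMatrix_eq hε 0, (hA0 z).scatteringMatrix_eq hε 0]
    -- Each off-diagonal entry is a Wronskian of two Jost solutions of the same column at opposite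
    -- ends, so the exponents add up to ∓ 2 i D t / ε.
    have h1 := hT.wronskian_jost_eq (hA0 z) (hA t ht z) (isAdmissible_one_atTop hε him.ge)
      (isAdmissible_one_atBot hε him.le) 0 0
    have h2 := hT.wronskian_jost_eq (hA0 z) (hA t ht z) (isAdmissible_zero_atBot hε him.ge)
      (isAdmissible_zero_atTop hε him.le) 0 0
    simp only [Matrix.of_apply, if_true, one_ne_zero, if_false, h1, h2]
    constructor <;> congr 2 <;> simp only [sigma3, if_true, one_ne_zero, if_false] <;> ring
  · obtain ⟨T, hT⟩ := hT t ht z he.1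
    obtain ⟨hu0, -⟩ := (hA0 z).existsUnique_isPropConst hε him he
    obtain ⟨hut, hne⟩ := (hA t ht z).existsUnique_isPropConst hε him ((heig t ht z).2 he)
    have h0 : IsPropConst ε (P 0) z (propConst ε (P 0) z) := Classical.epsilon_spec hu0.exists
    have h1 : IsPropConst ε (P t) z (propConst ε (P t) z) := Classical.epsilon_spec hut.exists
    exact ⟨hut, hne _ h1, hut.unique h1 (hT.isPropConst hε (hA0 z) (hA t ht z) him.le h0)⟩
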